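/- Let $G$ be a commutative reductive complex algebraic group ("reductive" meaning that every finite-dimensional rational representation is completely reducible), and let $V$ be a finite-dimensional faithful (rational) $G$-module. For $r\in\mathbb{N}$ let $V_{(r)}$ be the set of $v\in V$ whose isotropy group $G_v$ has dimension $r$, and assume that $V$ is $1$-modular, i.e. $\operatorname{codim}_V V_{(r)}\ge r+1$ for $1\le r\le \dim G$ (with $\operatorname{codim}\emptyset=\infty$). Let $U=V\oplus V^*$ with its canonical symplectic form, let $\mu\colon U\to\mathfrak{g}^*$, $\mu(x,\xi)(X)=\xi(Xx)$, be the canonical moment mapping, and let $N=\mu^{-1}(0)$ be the shell. Let $H=G_u$ be the isotropy group of a nonzero point $u\in N$ whose orbit $Gu$ is closed. Then there is a Lagrangian $G$-submodule $V'$ of $U$ (so that $U\simeq V'\oplus (V')^*$) such that all of the following hold: 1. $V'$ is stable, i.e. it has a nonempty Zariski-open subset consisting of points with closed $G$-orbits; 2. the $G$-submodule $(V')^H$ of $H$-fixed vectors is a stable $G$-module; 3. $H$ is the principal isotropy group of the $G$-module $(V')^H$, i.e. the set of points of the categorical quotient $(V')^H/\!\!/G$ whose corresponding closed orbit has isotropy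 group (conjugate, hence equal, to) $H$ is open and dense in $(V')^H/\!\!/G$. -/

import Mathlib

noncomputable section

namespace AlgGroup

open scoped Topology

/-! ### Zariski topologies and dimension -/

section Zariski

/-- The topology on `X` whose closed sets are the common zero loci of families of functions in
the algebra `A` (the non-vanishing sets of the members of `A` are a basis of open sets). -/
abbrev zariskiTopology {X : Type*} (A : Subalgebra ℂ (X → ℂ)) : TopologicalSpace X :=
  TopologicalSpace.generateFrom {D | ∃ f ∈ A, D = {x | f x ≠ 0}}

/-- The (Krull) dimension of a subset, for the subspace topology of the Zariski topology.
The empty set has dimension `⊥`, that is, minus infinity. -/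
def zariskiDim {X : Type*} (A : Subalgebra ℂ (X → ℂ)) (S : Set X) : WithBot ℕ∞ :=
  @topologicalKrullDim S (TopologicalSpace.induced Subtype.val (zariskiTopology A))

/-- The algebra `ℂ[V]` of polynomial functions on a complex vector space: it is generated by
the linear functionals. -/
def polynomialFunctions (V : Type*) [AddCommGroup V] [Module ℂ V] : Subalgebra ℂ (V → ℂ) :=
  Algebra.adjoin ℂ (Set.range fun (ξ : Module.Dual ℂ V) (v : V) => ξ v)

end Zariski

/-! ### Affine algebraic groups and their modules -/

/-- A complex affine algebraic group: a group that is an affine variety, given by its algebra of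
regular functions, such that multiplication and inversion are morphisms. -/
class AffineAlgebraicGroup (G : Type*) [Group G] where
  /-- the coordinate ring `ℂ[G]` -/
  regular : Subalgebra ℂ (G → ℂ)
  /-- `ℂ[G]` is a finitely generated algebra -/
  regular_fg : regular.FG
  /-- the points of `G` are the points of the affine variety with coordinate ring `ℂ[G]` -/
  eval_bijective : Function.Bijective fun g : G =>
    ((Pi.evalAlgHom ℂ (fun _ : G => ℂ) g).comp regular.val : regular →ₐ[ℂ] ℂ)
  /-- multiplication `G × G → G` is a morphism -/
  mul_regular : ∀ f ∈ regular, ∃ (n : ℕ) (a b : Fin n → G → ℂ),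
    (∀ i, a i ∈ regular) ∧ (∀ i, b i ∈ regular) ∧ ∀ g h, f (g * h) = ∑ i, a i g * b i h
  /-- inversion `G → G` is a morphism -/
  inv_regular : ∀ f ∈ regular, (fun g => f g⁻¹) ∈ regular

section Modules

variable {G : Type*} [Group G] {V : Type*} [AddCommGroup V] [Module ℂ V]

/-- The matrix coefficient `g ↦ ξ (g v)`. -/
def matrixCoeff (ρ : Representation ℂ G V) (ξ : Module.Dual ℂ V) (v : V) : G → ℂ :=
  fun g => ξ (ρ g v)

/-- A (finite-dimensional) representation is rational, that is, `V` is a `G`-module in the sense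
of algebraic groups, if all of its matrix coefficients are regular functions. -/
def IsRational [AffineAlgebraicGroup G] (ρ : Representation ℂ G V) : Prop :=
  ∀ (ξ : Module.Dual ℂ V) (v : V), matrixCoeff ρ ξ v ∈ AffineAlgebraicGroup.regular (G := G)

/-- `G` is reductive: every finite-dimensional rational representation of `G` is completely
reducible. -/
def IsReductive (G : Type*) [Group G] [AffineAlgebraicGroup G] : Prop :=
  ∀ (m : ℕ) (ρ : Representation ℂ G (Fin m → ℂ)), IsRational ρ → ρ.IsSemisimpleRepresentation

/-- The isotropy group `G_v`. -/
def isotropy (ρ : Representation ℂ G V) (v : V) : Subgroup G where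
  carrier := {g | ρ g v = v}
  one_mem' := by simp
  mul_mem' := by
    intro a b ha hb
    change ρ a v = v at ha
    change ρ b v = v at hb
    change ρ (a * b) v = v
    rw [map_mul, Module.End.mul_apply, hb, ha]
  inv_mem' := by
    intro a ha
    change ρ a v = v at ha
    change ρ a⁻¹ v = v
    conv_lhs => rw [← ha]
    simp

/-- The orbit `Gv`. -/
def orbit (ρ : Representation ℂ G V) (v : V) : Set V :=
  Set.range fun g => ρ g v

/-- The orbit `Gv` is (Zariski) closed in `V`. -/
def HasClosedOrbit (ρ : Representation ℂ G V) (v : V) : Prop :=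
  IsClosed[zariskiTopology (polynomialFunctions V)] (orbit ρ v)

/-- A `G`-module is stable if it has a nonempty open subset of closed orbits. -/
def IsStable (ρ : Representation ℂ G V) : Prop :=
  ∃ Ω : Set V, IsOpen[zariskiTopology (polynomialFunctions V)] Ω ∧ Ω.Nonempty ∧
    ∀ v ∈ Ω, HasClosedOrbit ρ v

/-- `V` is `k`-modular: `codim V_(r) ≥ r + k` for `1 ≤ r ≤ dim G`, where `V_(r)` is the set of
points whose isotropy group has dimension `r`. -/
def IsModular [AffineAlgebraicGroup G] (k : ℕ) (ρ : Representation ℂ G V) : Prop :=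
  ∀ r : ℕ, 1 ≤ r →
    (r : WithBot ℕ∞) ≤ zariskiDim (AffineAlgebraicGroup.regular (G := G)) Set.univ →
    zariskiDim (polynomialFunctions V)
        {v : V | zariskiDim (AffineAlgebraicGroup.regular (G := G)) (isotropy ρ v : Set G) = r}
      + ((r + k : ℕ) : WithBot ℕ∞) ≤ (Module.finrank ℂ V : WithBot ℕ∞)

/-- The algebra `ℂ[V]^G` of invariant polynomial functions. -/
def invariantFunctions (ρ : Representation ℂ G V) : Subalgebra ℂ (V → ℂ) where
  carrier := {f | f ∈ polynomialFunctions V ∧ ∀ g v, f (ρ g v) = f v}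
  mul_mem' := fun ha hb => ⟨mul_mem ha.1 hb.1, fun g v => by simp [ha.2 g v, hb.2 g v]⟩
  add_mem' := fun ha hb => ⟨add_mem ha.1 hb.1, fun g v => by simp [ha.2 g v, hb.2 g v]⟩
  algebraMap_mem' := fun c => ⟨Subalgebra.algebraMap_mem _ c, fun _ _ => rfl⟩

/-- The inverse image `V^{(H)}` in `V` of the stratum `(V//G)_{(H)}`: the points `x` such that the
closed orbit `Gy` in the fibre through `x` of the quotient map `V → V//G` has isotropy group
conjugate to `H`. Two points are in the same fibre if and only if all invariant polynomials agree
on them. -/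
def isotropyStratum (ρ : Representation ℂ G V) (H : Subgroup G) : Set V :=
  {x | ∃ y : V, (∀ f ∈ invariantFunctions ρ, f x = f y) ∧ HasClosedOrbit ρ y ∧
    ∃ g : G, isotropy ρ y = H.map (MulAut.conj g).toMonoidHom}

/-- `H` is a principal isotropy group of `V`: the stratum `(V//G)_{(H)}` is open and dense in
`V//G`. The Zariski topology of `V//G`, pulled back along the surjection `V → V//G`, is the one
defined by the invariant polynomials; so this says that the inverse image `V^{(H)}` of the stratum
is open and dense in that topology. -/
def IsPrincipalIsotropy (ρ : Representation ℂ G V) (H : Subgroup G) : Prop :=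
  IsOpen[zariskiTopology (invariantFunctions ρ)] (isotropyStratum ρ H) ∧
    @Dense V (zariskiTopology (invariantFunctions ρ)) (isotropyStratum ρ H)

/-- The `G`-submodule `V^H` of `H`-fixed vectors, for a normal subgroup `H`. -/
def fixedSubmodule (ρ : Representation ℂ G V) (H : Subgroup G) [H.Normal] :
    Subrepresentation ρ where
  toSubmodule := Representation.invariants (ρ.comp H.subtype)
  apply_mem_toSubmodule := fun g _ hv => Representation.le_comap_invariants ρ H g hv

/-! ### The symplectic module `V ⊕ V*` and the shell -/

/-- The `G`-module `U = V ⊕ V*`. -/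
def cotangentRep (ρ : Representation ℂ G V) : Representation ℂ G (V × Module.Dual ℂ V) :=
  ρ.prod ρ.dual

/-- A subspace of `V ⊕ V*` is Lagrangian if it equals its own orthogonal with respect to the
canonical symplectic form `((x, ξ), (y, η)) ↦ η x - ξ y`. -/
def IsLagrangian (L : Submodule ℂ (V × Module.Dual ℂ V)) : Prop :=
  ∀ u, u ∈ L ↔ ∀ w ∈ L, w.2 u.1 - u.2 w.1 = 0

/-- The Lie algebra of `G` (as a vector space): the tangent space at the identity, that is, the
point derivations of `ℂ[G]` at `1`. -/
def lieAlg (G : Type*) [Group G] [AffineAlgebraicGroup G] :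
    Submodule ℂ (Module.Dual ℂ (AffineAlgebraicGroup.regular (G := G))) where
  carrier := {δ | ∀ a b, δ (a * b) = a.1 1 * δ b + b.1 1 * δ a}
  zero_mem' := by simp
  add_mem' := by
    intro δ ε hδ hε a b
    simp only [LinearMap.add_apply, hδ a b, hε a b]
    ring
  smul_mem' := by
    intro c δ hδ a b
    simp only [LinearMap.smul_apply, smul_eq_mul, hδ a b]
    ring

/-- The canonical moment mapping `μ : V ⊕ V* → 𝔤*`, `μ(x, ξ)(X) = ξ(X x)`. Here `ξ(X x)` is the
derivative in the direction `X` at the identity of the matrix coefficient `g ↦ ξ(g x)`. -/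
def momentMap [AffineAlgebraicGroup G] (ρ : Representation ℂ G V) (hρ : IsRational ρ)
    (u : V × Module.Dual ℂ V) : Module.Dual ℂ (lieAlg G) where
  toFun X := X.1 ⟨matrixCoeff ρ u.2 u.1, hρ u.2 u.1⟩
  map_add' _ _ := rfl
  map_smul' _ _ := rfl

/-- The shell `N = μ⁻¹(0)`. -/
def shell [AffineAlgebraicGroup G] (ρ : Representation ℂ G V) (hρ : IsRational ρ) :
    Set (V × Module.Dual ℂ V) :=
  {u | momentMap ρ hρ u = 0}

end Modules

end AlgGroup

end

/-!
Everything reduces to the combinatorics of characters. Complete reducibility makes every rational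
`G`-module a sum of weight lines (`exists_weightCoord`). Applied to the translates of a regular
function, this shows that `ℂ[G]` is spanned by the characters (`span_charFun`), which are linearly
independent, so `ℂ[G]` is the group algebra of the character group. Hence a point of `G` is a
homomorphism from the character group to `ℂˣ`, and an additive homomorphism to `ℂ` gives an element
of the Lie algebra. As `ℂˣ` and `ℂ` are divisible, such homomorphisms can be prescribed on any
finite family of characters, subject only to the relations `∏ χ i ^ m i = 1` in the family
(`exists_forall_char_eq`, `exists_lieAlg_eq`).

In weight coordinates the orbit of `y` is closed if and only if the weights occurring in `y`, and no
others, enter a relation with positive exponents (`IsWeightCoord.hasClosedOrbit`,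
`IsWeightCoord.exists_relation`). In particular a module all of whose weights enter one positive
relation is stable, and its principal isotropy group is the common kernel of its weights
(`IsWeightCoord.isStable`, `IsWeightCoord.isPrincipalIsotropy`).

Let `χ i` be the weights of `V`, and let `B` be the set of those that are trivial on `H = G_u`.

* Every `χ i` enters a relation. Otherwise the common kernel of the other weights would be
  isomorphic to `ℂˣ`, and would be the isotropy group of the generic points of a coordinate
  hyperplane, which contradicts `1`-modularity (`IsWeightCoord.exists_relation_of_isModular`).
* Every `χ i` in `B` enters a relation within `B`
  (`IsWeightCoord.exists_relation_of_isotropy`). If `χ i` does not occur in `u = (x, ξ)`, it is a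
  monomial in the weights that do. If only one of `x i`, `ξ i` is nonzero, the positive relation for
  the closed orbit of `u` involves `χ i`. If both are nonzero, the equation `∑ x i ξ i dχ i = 0` of
  the shell provides the relation.

Therefore there are a relation `m₀` involving all the weights, and a relation `mB` involving exactly
those in `B`. For large `N` the relation `m = m₀ + N mB` has no zero exponent and has the signs of
`mB` on `B`. The Lagrangian submodule takes from `V ⊕ V*` the line of weight `χ i` if `m i > 0`, and
that of weight `(χ i)⁻¹` if `m i < 0`. On it `m` is a positive relation among all the weights, and
`mB` is one among the weights of the submodule fixed by `H`, whose common kernel is `H`.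
-/

noncomputable section

namespace AlgGroup

open scoped Topology

/-! ### Diagonalization -/

/-- A nonzero invariant subspace of minimal dimension consists of joint eigenvectors. -/
theorem exists_joint_eigenvector {G W : Type*} [CommGroup G] [AddCommGroup W] [Module ℂ W]
    [FiniteDimensional ℂ W] (ρ : Representation ℂ G W) (n : ℕ) :
    ∀ C : Submodule ℂ W, C ≠ ⊥ → Module.finrank ℂ C = n → (∀ g, ∀ v ∈ C, ρ g v ∈ C) →
      ∃ v ∈ C, v ≠ 0 ∧ ∀ g, ∃ c : ℂ, ρ g v = c • v := by
  induction n using Nat.strong_induction_on with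
  | _ n ih =>
  intro C hC hn hinv
  by_cases h : ∀ g, ∃ c : ℂ, ∀ v ∈ C, ρ g v = c • v
  · obtain ⟨v, hv, hv0⟩ := Submodule.exists_mem_ne_zero_of_ne_bot hC
    exact ⟨v, hv, hv0, fun g => (h g).imp fun c hc => hc v hv⟩
  push Not at h
  obtain ⟨g, hg⟩ := h
  have : Nontrivial C := Submodule.nontrivial_iff_ne_bot.2 hC
  obtain ⟨c, hc⟩ := Module.End.exists_eigenvalue ((ρ g).restrict (hinv g))
  obtain ⟨w, hw⟩ := hc.exists_hasEigenvector
  have hw1 : ρ g w = c • (w : W) := congrArg Subtype.val hw.apply_eq_smul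
  let D : Submodule ℂ W := C ⊓ Module.End.eigenspace (ρ g) c
  have hD : D ≠ ⊥ := by
    refine (Submodule.ne_bot_iff _).2 ⟨w, ⟨w.2, ?_⟩, ?_⟩
    · exact Module.End.mem_eigenspace_iff.2 hw1
    · simpa using hw.2
  have hDC : D < C := by
    refine lt_of_le_of_ne inf_le_left fun hEq => ?_
    obtain ⟨v, hv, hne⟩ := hg c
    rw [← hEq] at hv
    exact hne (Module.End.mem_eigenspace_iff.1 hv.2)
  have hlt := Submodule.finrank_lt_finrank_of_lt hDC
  obtain ⟨v, hv, h⟩ := ih _ (hn ▸ hlt) D hD rfl (by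
    intro k v hv
    refine ⟨hinv k v hv.1, Module.End.mem_eigenspace_iff.2 ?_⟩
    have := Module.End.mem_eigenspace_iff.1 hv.2
    rw [← Module.End.mul_apply, ← map_mul, mul_comm, map_mul, Module.End.mul_apply, this, map_smul])
  exact ⟨v, hv.1, h⟩

theorem span_joint_eigenvectors {G W : Type*} [CommGroup G] [AddCommGroup W] [Module ℂ W]
    [FiniteDimensional ℂ W] (ρ : Representation ℂ G W) [ρ.IsSemisimpleRepresentation] :
    Submodule.span ℂ {v | ∀ g, ∃ c : ℂ, ρ g v = c • v} = ⊤ := by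
  let S : Subrepresentation ρ :=
    { toSubmodule := Submodule.span ℂ {v | ∀ g, ∃ c : ℂ, ρ g v = c • v}
      apply_mem_toSubmodule := by
        intro g v hv
        induction hv using Submodule.span_induction with
        | mem x hx =>
          obtain ⟨c, hc⟩ := hx g
          rw [hc]
          exact Submodule.smul_mem _ _ (Submodule.subset_span hx)
        | zero => simp
        | add x y _ _ hx hy => rw [map_add]; exact add_mem hx hy
        | smul a x _ hx => rw [map_smul]; exact Submodule.smul_mem _ _ hx }
  obtain ⟨T, hT⟩ := exists_isCompl S
  have hT0 : T.toSubmodule = ⊥ := by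
    by_contra h
    obtain ⟨v, hv, hv0, h⟩ := exists_joint_eigenvector ρ _ T.toSubmodule h rfl
      (fun g v hv => T.apply_mem_toSubmodule g hv)
    have h1 : v ∈ S.toSubmodule := Submodule.subset_span h
    have h2 : v ∈ (S ⊓ T).toSubmodule := ⟨h1, hv⟩
    rw [hT.inf_eq_bot] at h2
    exact hv0 h2
  have h3 : (S ⊔ T).toSubmodule = ⊤ := by rw [hT.sup_eq_top]; rfl
  rw [Subrepresentation.toSubmodule_sup, hT0, sup_bot_eq] at h3
  exact h3

/-- The group of characters `G → ℂˣ` that are regular functions. -/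
def regularCharacters (G : Type*) [Group G] [AffineAlgebraicGroup G] : Subgroup (G →* ℂˣ) where
  carrier := {χ | (fun g => (χ g : ℂ)) ∈ AffineAlgebraicGroup.regular (G := G)}
  one_mem' := by
    exact one_mem (AffineAlgebraicGroup.regular (G := G))
  mul_mem' := by
    intro a b ha hb
    simpa using! mul_mem ha hb
  inv_mem' := by
    intro a ha
    simpa using! AffineAlgebraicGroup.inv_regular _ ha

/-- Linear coordinates on a representation in which the group acts diagonally, the `i`-th
coordinate being multiplied by the character `ψ i`. -/
def IsWeightCoord {G W ι : Type*} [Group G] [AffineAlgebraicGroup G] [AddCommGroup W] [Module ℂ W]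
    (ρ : Representation ℂ G W) (φ : W ≃ₗ[ℂ] (ι → ℂ)) (ψ : ι → regularCharacters G) : Prop :=
  ∀ g w i, φ (ρ g w) i = ((ψ i).1 g : ℂ) * φ w i

theorem exists_weightCoord {G W : Type*} [CommGroup G] [AffineAlgebraicGroup G]
    (hG : IsReductive G) [AddCommGroup W] [Module ℂ W] [FiniteDimensional ℂ W]
    (ρ : Representation ℂ G W) (hρ : IsRational ρ) :
    ∃ (φ : W ≃ₗ[ℂ] (Fin (Module.finrank ℂ W) → ℂ))
      (ψ : Fin (Module.finrank ℂ W) → regularCharacters G), IsWeightCoord ρ φ ψ := by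
  classical
  let e : W ≃ₗ[ℂ] (Fin (Module.finrank ℂ W) → ℂ) := (Module.finBasis ℂ W).equivFun
  let σ : Representation ℂ G (Fin (Module.finrank ℂ W) → ℂ) :=
    { toFun := fun g => e.toLinearMap ∘ₗ ρ g ∘ₗ e.symm.toLinearMap
      map_one' := by ext; simp
      map_mul' := by intro a b; ext; simp }
  have hσ : IsRational σ := fun ξ v => hρ (ξ ∘ₗ e.toLinearMap) (e.symm v)
  have := hG _ σ hσ
  let b := Module.Basis.ofSpan (span_joint_eigenvectors σ).ge
  have hb : ∀ i, ∀ g, ∃ c : ℂ, σ g (b i) = c • b i := fun i => by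
    have := Module.Basis.ofSpan_subset (span_joint_eigenvectors σ).ge ⟨i, rfl⟩
    exact this
  let b' := b.reindex (Fintype.equivOfCardEq (by
    rw [← Module.finrank_eq_card_basis b]; simp) :
      _ ≃ Fin (Module.finrank ℂ W))
  have hb' : ∀ i, ∀ g, ∃ c : ℂ, σ g (b' i) = c • b' i := fun i => by
    simp only [b', Module.Basis.reindex_apply]; exact hb _
  choose c hc using hb'
  have hmul : ∀ i g h, c i (g * h) = c i g * c i h := by
    intro i g h
    apply smul_left_injective ℂ (b'.ne_zero i)
    change c i (g * h) • b' i = (c i g * c i h) • b' i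
    rw [← hc, map_mul, Module.End.mul_apply, hc, map_smul, hc, smul_smul, mul_comm]
  have hone : ∀ i, c i 1 = 1 := by
    intro i
    apply smul_left_injective ℂ (b'.ne_zero i)
    change c i 1 • b' i = (1 : ℂ) • b' i
    rw [← hc]; simp
  let χ : ∀ i, G →* ℂ := fun i => ⟨⟨c i, hone i⟩, hmul i⟩
  refine ⟨e.trans b'.equivFun, fun i => ⟨(χ i).toHomUnits, ?_⟩, ?_⟩
  · have := hσ (b'.coord i) (b' i)
    change (fun g => c i g) ∈ AffineAlgebraicGroup.regular
    convert! this using 1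
    funext g
    simp [matrixCoeff, hc]
  · intro g w i
    have h1 : ∀ w, b'.repr (σ g w) i = c i g * b'.repr w i := by
      intro w
      have h : b'.coord i ∘ₗ σ g = c i g • b'.coord i := b'.ext fun j => by
        rcases eq_or_ne j i with rfl | hj <;> simp [*]
      exact LinearMap.congr_fun h w
    have h2 : e (ρ g w) = σ g (e w) := by simp [σ]
    change b'.repr (e (ρ g w)) i = c i g * b'.repr (e w) i
    rw [h2, h1]

/-! ### The coordinate ring is spanned by the characters -/

section CoordinateRing

variable {G : Type*} [CommGroup G] [AffineAlgebraicGroup G]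

/-- A regular character as a member of the coordinate ring. -/
def charFun (χ : regularCharacters G) : AffineAlgebraicGroup.regular (G := G) :=
  ⟨fun g => (χ.1 g : ℂ), χ.2⟩

@[simp] theorem charFun_apply (χ : regularCharacters G) (g : G) :
    (charFun χ).1 g = (χ.1 g : ℂ) := rfl

theorem charFun_mul (χ η : regularCharacters G) : charFun (χ * η) = charFun χ * charFun η := by
  ext g; simp

theorem charFun_one : charFun (1 : regularCharacters G) = 1 := by
  ext g; simp

theorem linearIndependent_regularCharacters :
    LinearIndependent ℂ fun (χ : regularCharacters G) (g : G) => (χ.1 g : ℂ) := by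
  have h := linearIndependent_monoidHom G ℂ
  refine h.comp (fun χ : regularCharacters G => (Units.coeHom ℂ).comp χ.1) ?_
  intro χ η h
  ext g
  exact DFunLike.congr_fun h g

theorem linearIndependent_charFun :
    LinearIndependent ℂ (charFun : regularCharacters G → _) :=
  LinearIndependent.of_comp (AffineAlgebraicGroup.regular (G := G)).val.toLinearMap
    linearIndependent_regularCharacters

/-- A linear combination of characters equal to a nonzero multiple of a character `η` has `η`
among its terms. -/
theorem exists_eq_of_sum_eq {α : Type*} (s : Finset α) (c : α → ℂ) (ψ : α → regularCharacters G)
    (η : regularCharacters G) {d : ℂ} (hd : d ≠ 0)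
    (h : ∀ g, ∑ a ∈ s, c a * ((ψ a).1 g : ℂ) = d * (η.1 g : ℂ)) :
    ∃ a ∈ s, c a ≠ 0 ∧ ψ a = η := by
  by_contra! hcon
  have h0 := linearIndependent_regularCharacters (G := G)
  refine h0.notMem_span_image (s := {χ | χ ≠ η}) (x := η) (by simp) ?_
  have h1 : (fun g => (η.1 g : ℂ)) = ∑ a ∈ s, (d⁻¹ * c a) • fun g => ((ψ a).1 g : ℂ) := by
    funext g
    simp only [Finset.sum_apply, Pi.smul_apply, smul_eq_mul, mul_assoc]
    rw [← Finset.mul_sum, h g, inv_mul_cancel_left₀ hd]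
  rw [h1]
  refine Submodule.sum_mem _ fun a ha => ?_
  by_cases hc : c a = 0
  · simp [hc]
  · exact Submodule.smul_mem _ _ (Submodule.subset_span ⟨ψ a, hcon a ha hc, rfl⟩)

/-- The translates of a regular function span a finite-dimensional rational representation, so
the function is a sum of eigenvectors for translation, which are multiples of characters. -/
theorem span_charFun (hG : IsReductive G) :
    Submodule.span ℂ (Set.range (charFun : regularCharacters G → _)) = ⊤ := by
  refine Submodule.eq_top_iff'.2 fun f => ?_
  -- the regular representation on all functions
  let τ : Representation ℂ G (G → ℂ) :=
    { toFun := fun h => LinearMap.funLeft ℂ ℂ (fun g => g * h)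
      map_one' := by ext; simp [LinearMap.funLeft]
      map_mul' := by
        intro a b; ext F g
        simp [LinearMap.funLeft_apply, mul_left_comm, mul_comm] }
  have hτ : ∀ h F g, τ h F g = F (g * h) := fun _ _ _ => rfl
  have htr : ∀ F ∈ AffineAlgebraicGroup.regular (G := G), ∃ (n : ℕ) (a b : Fin n → G → ℂ),
      (∀ i, a i ∈ AffineAlgebraicGroup.regular) ∧ (∀ i, b i ∈ AffineAlgebraicGroup.regular) ∧
      ∀ h, τ h F = ∑ i, b i h • a i := by
    intro F hF
    obtain ⟨n, a, b, ha, hb, hab⟩ := AffineAlgebraicGroup.mul_regular F hF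
    refine ⟨n, a, b, ha, hb, fun h => ?_⟩
    funext g
    rw [hτ, hab]
    simp [mul_comm]
  let W : Submodule ℂ (G → ℂ) := Submodule.span ℂ (Set.range fun h => τ h f.1)
  have hWinv : ∀ h, ∀ F ∈ W, τ h F ∈ W := by
    intro h F hF
    induction hF using Submodule.span_induction with
    | mem x hx =>
      obtain ⟨k, rfl⟩ := hx
      refine Submodule.subset_span ⟨h * k, ?_⟩
      simp only [map_mul, Module.End.mul_apply]
    | zero => simp
    | add x y _ _ hx hy => rw [map_add]; exact add_mem hx hy
    | smul a x _ hx => rw [map_smul]; exact Submodule.smul_mem _ _ hx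
  have hWreg : W ≤ Subalgebra.toSubmodule (AffineAlgebraicGroup.regular (G := G)) := by
    refine Submodule.span_le.2 ?_
    rintro _ ⟨h, rfl⟩
    obtain ⟨n, a, b, ha, hb, hab⟩ := htr f.1 f.2
    simp only [SetLike.mem_coe, hab]
    exact Submodule.sum_mem _ fun i _ => Submodule.smul_mem _ _ (ha i)
  have hfin : FiniteDimensional ℂ W := by
    obtain ⟨n, a, b, ha, hb, hab⟩ := htr f.1 f.2
    have hle : W ≤ Submodule.span ℂ (Set.range a) := by
      refine Submodule.span_le.2 ?_
      rintro _ ⟨h, rfl⟩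
      simp only [SetLike.mem_coe, hab]
      exact Submodule.sum_mem _ fun i _ =>
        Submodule.smul_mem _ _ (Submodule.subset_span ⟨i, rfl⟩)
    have : FiniteDimensional ℂ (Submodule.span ℂ (Set.range a)) :=
      FiniteDimensional.span_of_finite ℂ (Set.finite_range a)
    exact Submodule.finiteDimensional_of_le hle
  let S : Subrepresentation τ := ⟨W, hWinv⟩
  have hrat : IsRational S.toRepresentation := by
    intro ξ v
    obtain ⟨ξ', hξ'⟩ := ξ.exists_extend
    obtain ⟨n, a, b, ha, hb, hab⟩ := htr v.1 (hWreg v.2)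
    have : matrixCoeff S.toRepresentation ξ v = ∑ i, ξ' (a i) • b i := by
      funext h
      have h2 : ξ (S.toRepresentation h v) = ξ' (τ h v.1) := by
        rw [← hξ']; rfl
      rw [matrixCoeff, h2, hab]
      simp [mul_comm]
    rw [this]
    exact Subalgebra.sum_mem _ fun i _ => Subalgebra.smul_mem _ (hb i) _
  obtain ⟨φ, ψ, hφ⟩ := exists_weightCoord hG S.toRepresentation hrat
  have hfW : f.1 ∈ W := Submodule.subset_span ⟨1, by simp⟩
  have hsum : f.1 = ∑ i, (φ ⟨f.1, hfW⟩ i * ((φ.symm (Pi.single i 1)).1 1)) • (charFun (ψ i)).1 := by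
    have h1 : (⟨f.1, hfW⟩ : W) = ∑ i, φ ⟨f.1, hfW⟩ i • φ.symm (Pi.single i 1) := by
      apply φ.injective
      rw [map_sum]
      simp only [map_smul, LinearEquiv.apply_symm_apply]
      funext j
      simp [Pi.single_apply]
    have h2 : ∀ i g, (φ.symm (Pi.single i 1)).1 g
        = (φ.symm (Pi.single i 1)).1 1 * ((ψ i).1 g : ℂ) := by
      intro i g
      have h3 : S.toRepresentation g (φ.symm (Pi.single i 1)) =
          ((ψ i).1 g : ℂ) • φ.symm (Pi.single i 1) := by
        apply φ.injective
        funext j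
        rw [hφ, map_smul, LinearEquiv.apply_symm_apply]
        rcases eq_or_ne j i with rfl | hj <;> simp [*]
      have h4 := congrArg (fun w : W => w.1 1) h3
      have h5 : (S.toRepresentation g (φ.symm (Pi.single i 1))).1 1
          = (φ.symm (Pi.single i 1)).1 (1 * g) := rfl
      simp only [h5, one_mul] at h4
      rw [h4]
      simp [mul_comm]
    conv_lhs => rw [show f.1 = (⟨f.1, hfW⟩ : W).1 from rfl, h1]
    funext g
    simp only [Submodule.coe_sum, Submodule.coe_smul, Finset.sum_apply, Pi.smul_apply, smul_eq_mul,
      charFun_apply, mul_assoc]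
    exact Finset.sum_congr rfl fun i _ => by rw [h2 i g]
  have hsum' : f = ∑ i, (φ ⟨f.1, hfW⟩ i * ((φ.symm (Pi.single i 1)).1 1)) • charFun (ψ i) := by
    apply Subtype.ext
    conv_lhs => rw [hsum]
    simp
  rw [hsum']
  exact Submodule.sum_mem _ fun i _ =>
    Submodule.smul_mem _ _ (Submodule.subset_span ⟨_, rfl⟩)

/-- The basis of `ℂ[G]` formed by the characters. -/
def charBasis (hG : IsReductive G) :
    Module.Basis (regularCharacters G) ℂ (AffineAlgebraicGroup.regular (G := G)) :=
  Module.Basis.mk linearIndependent_charFun (span_charFun hG).ge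

@[simp] theorem charBasis_apply (hG : IsReductive G) (χ : regularCharacters G) :
    charBasis hG χ = charFun χ := by simp [charBasis]

/-- Every homomorphism from the character group to `ℂˣ` is evaluation at a point of `G`. -/
theorem exists_eval_eq (hG : IsReductive G) (θ : regularCharacters G →* ℂˣ) :
    ∃ g : G, ∀ χ : regularCharacters G, χ.1 g = θ χ := by
  let L : AffineAlgebraicGroup.regular (G := G) →ₗ[ℂ] ℂ :=
    (charBasis hG).constr ℂ fun χ => (θ χ : ℂ)
  have hL : ∀ χ, L (charFun χ) = θ χ := fun χ => by
    rw [← charBasis_apply hG χ]; exact Module.Basis.constr_basis _ _ _ _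
  have hmul : ∀ a b, L (a * b) = L a * L b := by
    have : (LinearMap.mul ℂ _).compr₂ L = (LinearMap.mul ℂ ℂ).compl₁₂ L L := by
      refine (charBasis hG).ext fun χ => (charBasis hG).ext fun η => ?_
      simp [← charFun_mul, hL]
    exact fun a b => LinearMap.congr_fun₂ this a b
  obtain ⟨g, hg⟩ := AffineAlgebraicGroup.eval_bijective.2
    (AlgHom.ofLinearMap L (by rw [← charFun_one, hL]; simp) hmul)
  refine ⟨g, fun χ => Units.ext ?_⟩
  have := DFunLike.congr_fun hg (charFun χ)
  change (χ.1 g : ℂ) = L (charFun χ) at this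
  rw [this, hL]

/-- An additive homomorphism from the character group to `ℂ` defines an element of the Lie
algebra. -/
theorem exists_lieAlg_eq (hG : IsReductive G) (θ : Additive (regularCharacters G) →+ ℂ) :
    ∃ X : lieAlg G, ∀ χ : regularCharacters G, X.1 (charFun χ) = θ (Additive.ofMul χ) := by
  let L : AffineAlgebraicGroup.regular (G := G) →ₗ[ℂ] ℂ :=
    (charBasis hG).constr ℂ fun χ => θ (Additive.ofMul χ)
  have hL : ∀ χ, L (charFun χ) = θ (Additive.ofMul χ) := fun χ => by
    rw [← charBasis_apply hG χ]; exact Module.Basis.constr_basis _ _ _ _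
  let ε : AffineAlgebraicGroup.regular (G := G) →ₗ[ℂ] ℂ :=
    ((Pi.evalAlgHom ℂ (fun _ : G => ℂ) 1).comp
      (AffineAlgebraicGroup.regular (G := G)).val).toLinearMap
  have hε : ∀ χ, ε (charFun χ) = 1 := fun χ => by
    change (χ.1 1 : ℂ) = 1
    simp
  refine ⟨⟨L, ?_⟩, hL⟩
  have : (LinearMap.mul ℂ _).compr₂ L =
      (LinearMap.mul ℂ ℂ).compl₁₂ ε L + (LinearMap.mul ℂ ℂ).compl₁₂ L ε := by
    refine (charBasis hG).ext fun χ => (charBasis hG).ext fun η => ?_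
    simp [← charFun_mul, hL, hε, add_comm]
  intro a b
  have h := LinearMap.congr_fun₂ this a b
  change L (a * b) = ε a * L b + L a * ε b at h
  rw [h, mul_comm (L a)]
  rfl

end CoordinateRing

/-! ### Extending homomorphisms along relations -/

/-- If every integral relation among the `ψ i` holds for the `t i`, and the `t i` lie in a
divisible group, then some homomorphism maps each `ψ i` to `t i`. -/
theorem exists_addHom_of_relations {X A ι : Type*} [AddCommGroup X] [AddCommGroup A]
    [DivisibleBy A ℤ] [Fintype ι] (ψ : ι → X) (t : ι → A)
    (h : ∀ m : ι → ℤ, ∑ i, m i • ψ i = 0 → ∑ i, m i • t i = 0) :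
    ∃ θ : X →+ A, ∀ i, θ (ψ i) = t i := by
  classical
  let p : (ι → ℤ) →ₗ[ℤ] X := Fintype.linearCombination ℤ ψ
  let q : (ι → ℤ) →ₗ[ℤ] A := Fintype.linearCombination ℤ t
  have hpq : p.ker ≤ q.ker := fun m hm => h m hm
  obtain ⟨θ, hθ⟩ := (Module.Baer.of_divisible A).extension_property
    (p.ker.liftQ p le_rfl) (LinearMap.ker_eq_bot.1 (Submodule.ker_liftQ_eq_bot _ _ _ le_rfl))
    (p.ker.liftQ q hpq)
  refine ⟨θ.toAddMonoidHom, fun i => ?_⟩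
  have := LinearMap.congr_fun hθ (p.ker.mkQ (Pi.single i 1))
  simpa [p, q] using! this

theorem units_exists_pow_eq (n : ℕ) (hn : n ≠ 0) (z : ℂˣ) : ∃ w : ℂˣ, w ^ n = z := by
  obtain ⟨w, hw⟩ := IsAlgClosed.exists_pow_nat_eq (z : ℂ) (Nat.pos_of_ne_zero hn)
  have hw0 : w ≠ 0 := by
    rintro rfl
    rw [zero_pow hn] at hw
    exact z.ne_zero hw.symm
  exact ⟨Units.mk0 w hw0, Units.ext (by simpa using hw)⟩

/-- The multiplicative form of `exists_addHom_of_relations`, with values in `ℂˣ`. -/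
theorem exists_hom_of_relations {X ι : Type*} [CommGroup X] [Fintype ι] (ψ : ι → X) (t : ι → ℂˣ)
    (h : ∀ m : ι → ℤ, ∏ i, ψ i ^ m i = 1 → ∏ i, t i ^ m i = 1) :
    ∃ θ : X →* ℂˣ, ∀ i, θ (ψ i) = t i := by
  let _ : DivisibleBy (Additive ℂˣ) ℕ := divisibleByOfSMulRightSurj _ _ fun {n} hn z =>
    (units_exists_pow_eq n hn z.toMul).imp fun w hw => congrArg Additive.ofMul hw
  let _ : DivisibleBy (Additive ℂˣ) ℤ := AddGroup.divisibleByIntOfDivisibleByNat _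
  obtain ⟨θ, hθ⟩ := exists_addHom_of_relations (fun i => Additive.ofMul (ψ i))
    (fun i => Additive.ofMul (t i)) fun m hm =>
      congrArg Additive.ofMul (h m (congrArg Additive.toMul hm))
  exact ⟨MonoidHom.toAdditive.symm θ, fun i => congrArg Additive.toMul (hθ i)⟩

section Points

variable {G : Type*} [CommGroup G] [AffineAlgebraicGroup G] (hG : IsReductive G)
  {ι : Type*} [Fintype ι] (ψ : ι → regularCharacters G)
include hG

/-- The image of `G` under a family of characters is cut out by the relations among them. -/
theorem exists_forall_char_eq (t : ι → ℂˣ)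
    (h : ∀ m : ι → ℤ, ∏ i, ψ i ^ m i = 1 → ∏ i, t i ^ m i = 1) :
    ∃ g : G, ∀ i, (ψ i).1 g = t i := by
  obtain ⟨θ, hθ⟩ := exists_hom_of_relations ψ t h
  obtain ⟨g, hg⟩ := exists_eval_eq hG θ
  exact ⟨g, fun i => (hg _).trans (hθ i)⟩

/-- A character that is trivial on the common kernel of the `ψ i` is a monomial in them. -/
theorem exists_eq_prod_zpow_of_forall_eq_one (η : regularCharacters G)
    (h : ∀ g : G, (∀ i, (ψ i).1 g = 1) → η.1 g = 1) :
    ∃ m : ι → ℤ, η = ∏ i, ψ i ^ m i := by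
  classical
  -- `K` is the group of exponents `k` such that `η ^ k` is a monomial
  let K : AddSubgroup ℤ :=
    { carrier := {k | ∃ m : ι → ℤ, η ^ k = ∏ i, ψ i ^ m i}
      zero_mem' := ⟨0, by simp⟩
      add_mem' := by
        rintro a b ⟨m, hm⟩ ⟨m', hm'⟩
        exact ⟨m + m', by simp [zpow_add, hm, hm', Finset.prod_mul_distrib]⟩
      neg_mem' := by
        rintro a ⟨m, hm⟩
        exact ⟨-m, by simp [zpow_neg, hm]⟩ }
  obtain ⟨k, hk⟩ := Int.subgroup_cyclic K
  rw [← AddSubgroup.zmultiples_eq_closure] at hk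
  -- otherwise some value other than `1` of `η` is compatible with all relations
  have key : ∀ t : ℂˣ, t ^ k = 1 → t = 1 := by
    intro t ht
    obtain ⟨g, hg⟩ := exists_forall_char_eq hG (fun o : Option ι => o.elim η ψ)
      (fun o => o.elim t fun _ => 1) (by
        intro m hm
        simp only [Fintype.prod_option, Option.elim_none, Option.elim_some, one_zpow,
          Finset.prod_const_one, mul_one] at hm ⊢
        have : m none ∈ K := ⟨fun i => - m (some i), by
          simpa [mul_eq_one_iff_eq_inv] using hm⟩
        rw [hk, AddSubgroup.mem_zmultiples_iff] at this
        obtain ⟨n, hn⟩ := this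
        rw [← hn, smul_eq_mul, mul_comm, zpow_mul, ht, one_zpow])
    refine (hg none).symm.trans ?_
    exact h g fun i => hg (some i)
  have hunit : IsUnit k := by
    rw [Int.isUnit_iff_natAbs_eq]
    by_contra hk1
    by_cases hk0 : k.natAbs = 0
    · have h2 := key (Units.mk0 2 two_ne_zero) (by simp [Int.natAbs_eq_zero.1 hk0])
      have h3 := congrArg Units.val h2
      norm_num at h3
    · obtain ⟨N, hN⟩ : ∃ N, N = k.natAbs := ⟨_, rfl⟩
      rw [← hN] at hk0 hk1
      have hp := Complex.isPrimitiveRoot_exp N hk0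
      have hu : (hp.isUnit hk0).unit ^ N = 1 := Units.ext (by simpa using hp.pow_eq_one)
      have h1 := key (hp.isUnit hk0).unit (by
        rcases Int.natAbs_eq k with h | h <;> rw [h, ← hN] <;> simp [hu])
      exact hp.ne_one (by omega) (by simpa using congrArg Units.val h1)
  have h1 : (1 : ℤ) ∈ K := by
    rw [hk, AddSubgroup.mem_zmultiples_iff]
    rcases Int.isUnit_iff.1 hunit with h | h
    · exact ⟨1, by simp [h]⟩
    · exact ⟨-1, by simp [h]⟩
  obtain ⟨m, hm⟩ := h1
  exact ⟨m, by simpa using hm⟩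

end Points

/-! ### Zariski topologies and polynomial functions -/

section Zariski

theorem zariskiTopology_isBasis {X : Type*} (A : Subalgebra ℂ (X → ℂ)) :
    @TopologicalSpace.IsTopologicalBasis X (zariskiTopology A)
      {D | ∃ f ∈ A, D = {x | f x ≠ 0}} := by
  refine @TopologicalSpace.isTopologicalBasis_of_subbasis_of_finiteInter X (zariskiTopology A) _ rfl
    ⟨⟨1, one_mem A, by simp⟩, ?_⟩
  rintro _ ⟨f, hf, rfl⟩ _ ⟨h, hh, rfl⟩
  exact ⟨f * h, mul_mem hf hh, by ext; simp⟩

theorem isOpen_ne_zero {X : Type*} {A : Subalgebra ℂ (X → ℂ)} {f : X → ℂ} (hf : f ∈ A) :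
    IsOpen[zariskiTopology A] {x | f x ≠ 0} :=
  TopologicalSpace.isOpen_generateFrom_of_mem ⟨f, hf, rfl⟩

theorem isClosed_eq_zero {X : Type*} {A : Subalgebra ℂ (X → ℂ)} {f : X → ℂ} (hf : f ∈ A) :
    IsClosed[zariskiTopology A] {x | f x = 0} := by
  let _ := zariskiTopology A
  exact ⟨isOpen_ne_zero hf⟩

theorem exists_ne_zero_of_notMem {X : Type*} {A : Subalgebra ℂ (X → ℂ)} {C : Set X}
    (hC : IsClosed[zariskiTopology A] C) {x : X} (hx : x ∉ C) :
    ∃ f ∈ A, f x ≠ 0 ∧ ∀ y ∈ C, f y = 0 := by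
  let _ := zariskiTopology A
  obtain ⟨_, ⟨f, hf, rfl⟩, hfx, hfC⟩ :=
    (zariskiTopology_isBasis A).exists_subset_of_mem_open hx hC.isOpen_compl
  exact ⟨f, hf, hfx, fun y hy => by
    by_contra h
    exact hfC h hy⟩

variable {W : Type*} [AddCommGroup W] [Module ℂ W]

theorem polynomialFunctions_linear (ξ : Module.Dual ℂ W) :
    (fun w => ξ w) ∈ polynomialFunctions W :=
  Algebra.subset_adjoin ⟨ξ, rfl⟩

theorem exists_mvPolynomial_eq {ι : Type*} [Fintype ι] (φ : W ≃ₗ[ℂ] (ι → ℂ)) {f : W → ℂ}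
    (hf : f ∈ polynomialFunctions W) :
    ∃ p : MvPolynomial ι ℂ, ∀ w, f w = MvPolynomial.eval (φ w) p := by
  classical
  induction hf using Algebra.adjoin_induction with
  | mem f hf =>
    obtain ⟨ξ, rfl⟩ := hf
    refine ⟨∑ i, MvPolynomial.C (ξ (φ.symm (Pi.single i 1))) * MvPolynomial.X i, fun w => ?_⟩
    have h : w = ∑ i, φ w i • φ.symm (Pi.single i 1) := by
      apply φ.injective
      funext j
      simp [Pi.single_apply]
    conv_lhs => rw [h]
    simp [mul_comm]
  | algebraMap c => exact ⟨MvPolynomial.C c, fun w => by simp⟩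
  | add f h _ _ hf hh =>
    obtain ⟨p, hp⟩ := hf
    obtain ⟨q, hq⟩ := hh
    exact ⟨p + q, fun w => by simp [hp, hq]⟩
  | mul f h _ _ hf hh =>
    obtain ⟨p, hp⟩ := hf
    obtain ⟨q, hq⟩ := hh
    exact ⟨p * q, fun w => by simp [hp, hq]⟩

/-- A polynomial function restricts to a polynomial on every line. -/
theorem exists_polynomial_eq_on_line {f : W → ℂ} (hf : f ∈ polynomialFunctions W) (p q : W) :
    ∃ P : Polynomial ℂ, ∀ s : ℂ, f (p + s • (q - p)) = P.eval s := by
  induction hf using Algebra.adjoin_induction with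
  | mem f hf =>
    obtain ⟨ξ, rfl⟩ := hf
    exact ⟨Polynomial.C (ξ p) + Polynomial.X * Polynomial.C (ξ (q - p)), fun s => by simp⟩
  | algebraMap c => exact ⟨Polynomial.C c, fun w => by simp⟩
  | add f h _ _ hf hh =>
    obtain ⟨P, hP⟩ := hf
    obtain ⟨Q, hQ⟩ := hh
    exact ⟨P + Q, fun w => by simp [hP, hQ]⟩
  | mul f h _ _ hf hh =>
    obtain ⟨P, hP⟩ := hf
    obtain ⟨Q, hQ⟩ := hh
    exact ⟨P * Q, fun w => by simp [hP, hQ]⟩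

/-- The affine line through `p` and `q` contains a point at which neither `f` nor `h` vanishes. This
is how irreducibility of subsets of a vector space is proved below. -/
theorem exists_line_ne_zero {f h : W → ℂ} (hf : f ∈ polynomialFunctions W)
    (hh : h ∈ polynomialFunctions W) {p q : W} (hp : f p ≠ 0) (hq : h q ≠ 0) :
    ∃ s : ℂ, f (p + s • (q - p)) ≠ 0 ∧ h (p + s • (q - p)) ≠ 0 := by
  obtain ⟨P, hP⟩ := exists_polynomial_eq_on_line hf p q
  obtain ⟨Q, hQ⟩ := exists_polynomial_eq_on_line hh p q
  have hP0 : P ≠ 0 := by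
    rintro rfl
    exact hp (by simpa using hP 0)
  have hQ0 : Q ≠ 0 := by
    rintro rfl
    exact hq (by simpa using hQ 1)
  by_contra! hcon
  refine mul_ne_zero hP0 hQ0 (Polynomial.funext fun s => ?_)
  rw [Polynomial.eval_mul, Polynomial.eval_zero, ← hP, ← hQ]
  by_cases h0 : f (p + s • (q - p)) = 0
  · rw [h0, zero_mul]
  · rw [hcon s h0, mul_zero]

end Zariski

/-! ### Orbits in weight coordinates -/

section Orbits

variable {G : Type*} [CommGroup G] [AffineAlgebraicGroup G] {ι : Type*} [Fintype ι]
  {W : Type*} [AddCommGroup W] [Module ℂ W] {ρ : Representation ℂ G W}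
  {φ : W ≃ₗ[ℂ] (ι → ℂ)} {ψ : ι → regularCharacters G}

theorem val_prod_pow (ψ : ι → regularCharacters G) (a : ι → ℕ) (g : G) :
    ((∏ i, ψ i ^ a i : regularCharacters G).1 g : ℂ) = ∏ i, ((ψ i).1 g : ℂ) ^ a i := by
  simp

theorem IsWeightCoord.prod_pow_apply (hφ : IsWeightCoord ρ φ ψ) (a : ι → ℕ) (g : G) (w : W) :
    ∏ i, φ (ρ g w) i ^ a i =
      ((∏ i, ψ i ^ a i : regularCharacters G).1 g : ℂ) * ∏ i, φ w i ^ a i := by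
  rw [val_prod_pow, ← Finset.prod_mul_distrib]
  exact Finset.prod_congr rfl fun i _ => by rw [hφ, mul_pow]

omit [Fintype ι] in
theorem IsWeightCoord.mem_isotropy_iff (hφ : IsWeightCoord ρ φ ψ) (w : W) (g : G) :
    g ∈ isotropy ρ w ↔ ∀ i, φ w i ≠ 0 → (ψ i).1 g = 1 := by
  change ρ g w = w ↔ _
  rw [← φ.injective.eq_iff, funext_iff]
  refine forall_congr' fun i => ?_
  rw [hφ]
  constructor
  · intro h h0
    exact Units.ext (mul_right_cancel₀ h0 (by simpa using h))
  · intro h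
    by_cases h0 : φ w i = 0
    · simp [h0]
    · simp [h h0]

theorem prod_pow_mem_polynomialFunctions (φ : W ≃ₗ[ℂ] (ι → ℂ)) (a : ι → ℕ) :
    (fun w => ∏ i, φ w i ^ a i) ∈ polynomialFunctions W := by
  have : (fun w => ∏ i, φ w i ^ a i) = ∏ i, (fun w => φ w i) ^ a i := by
    funext w; simp
  rw [this]
  exact prod_mem fun i _ => pow_mem
    (polynomialFunctions_linear ((LinearMap.proj i).comp φ.toLinearMap)) _

theorem IsWeightCoord.prod_pow_mem_invariantFunctions (hφ : IsWeightCoord ρ φ ψ) (a : ι → ℕ)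
    (ha : ∏ i, ψ i ^ a i = 1) :
    (fun w => ∏ i, φ w i ^ a i) ∈ invariantFunctions ρ :=
  ⟨prod_pow_mem_polynomialFunctions φ a, fun g w => by
    simp only [hφ.prod_pow_apply, ha]
    simp⟩

/-- If there is a relation with positive exponents among exactly those weights that occur in `y`,
then the orbit of `y` is closed: it is cut out by the invariant monomial of that relation, the
vanishing coordinates of `y`, and the binomial equations coming from all relations. -/
theorem IsWeightCoord.hasClosedOrbit (hG : IsReductive G) (hφ : IsWeightCoord ρ φ ψ) (y : W)
    (a : ι → ℕ) (ha : ∏ i, ψ i ^ a i = 1) (hsupp : ∀ i, a i ≠ 0 ↔ φ y i ≠ 0) :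
    HasClosedOrbit ρ y := by
  classical
  let _ := zariskiTopology (polynomialFunctions W)
  have hy : ∏ i, φ y i ^ a i ≠ 0 := Finset.prod_ne_zero_iff.2 fun i _ => by
    by_cases h : a i = 0
    · simp [h]
    · exact pow_ne_zero _ ((hsupp i).1 h)
  have horb : orbit ρ y = {z | ∏ i, φ z i ^ a i - ∏ i, φ y i ^ a i = 0} ∩
      ((⋂ i ∈ {i | φ y i = 0}, {z | φ z i = 0}) ∩
      ⋂ pq ∈ {pq : (ι → ℕ) × (ι → ℕ) | ∏ i, ψ i ^ pq.1 i = ∏ i, ψ i ^ pq.2 i},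
        {z | (∏ i, φ z i ^ pq.1 i) * ∏ i, φ y i ^ pq.2 i -
          (∏ i, φ z i ^ pq.2 i) * ∏ i, φ y i ^ pq.1 i = 0}) := by
    ext z
    simp only [Set.mem_inter_iff, Set.mem_iInter, Set.mem_ofPred_eq, sub_eq_zero]
    constructor
    · rintro ⟨g, rfl⟩
      refine ⟨by rw [hφ.prod_pow_apply, ha]; simp, fun i hi => by rw [hφ, hi, mul_zero], ?_⟩
      rintro ⟨p, q⟩ hpq
      rw [hφ.prod_pow_apply, hφ.prod_pow_apply, hpq]
      ring
    · rintro ⟨h1, h2, h3⟩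
      have hz : ∀ i, φ y i ≠ 0 → φ z i ≠ 0 := by
        intro i hi h0
        rw [← h1] at hy
        exact hy (Finset.prod_eq_zero (Finset.mem_univ i)
          (by rw [h0, zero_pow ((hsupp i).2 hi)]))
      let t : ι → ℂˣ := fun i => if h : φ y i ≠ 0 then Units.mk0 (φ z i / φ y i)
        (div_ne_zero (hz i h) h) else 1
      obtain ⟨g, hg⟩ := exists_forall_char_eq hG (fun i => if φ y i ≠ 0 then ψ i else 1) t (by
        intro m hm
        let p : ι → ℕ := fun i => if φ y i ≠ 0 then (m i).toNat else 0
        let q : ι → ℕ := fun i => if φ y i ≠ 0 then (-m i).toNat else 0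
        have hψ : ∀ i, (if φ y i ≠ 0 then ψ i else 1) ^ m i = ψ i ^ p i / ψ i ^ q i := by
          intro i
          by_cases h : φ y i ≠ 0
          · simp only [p, q, if_pos h]
            rw [← zpow_natCast, ← zpow_natCast, div_eq_mul_inv, ← zpow_sub, Int.toNat_sub_toNat_neg]
          · simp only [p, q, if_neg h]
            simp
        have ht : ∀ i, (t i : ℂ) ^ m i =
            (φ z i ^ p i * φ y i ^ q i) / (φ z i ^ q i * φ y i ^ p i) := by
          intro i
          by_cases h : φ y i ≠ 0
          · have hz' := hz i h
            have : (t i : ℂ) = φ z i / φ y i := by simp [t, h]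
            rw [this]
            have hm : m i = (p i : ℤ) - q i := by
              simp only [p, q, if_pos h]
              rw [Int.toNat_sub_toNat_neg]
            rw [hm, zpow_sub₀ (div_ne_zero hz' h), zpow_natCast, zpow_natCast, div_pow, div_pow]
            field_simp
          · simp only [p, q, t, if_neg h, dif_neg h]
            simp
        simp only [hψ, Finset.prod_div_distrib, div_eq_one] at hm
        have h4 := h3 (p, q) hm
        apply Units.ext
        rw [Units.coe_prod]
        simp only [Units.val_zpow_eq_zpow_val, ht, Finset.prod_div_distrib,
          Finset.prod_mul_distrib, Units.val_one]
        rw [h4]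
        refine div_self (mul_ne_zero ?_ ?_) <;> refine Finset.prod_ne_zero_iff.2 fun i _ => ?_
        all_goals
          by_cases h : φ y i ≠ 0
          · first
              | exact pow_ne_zero _ (hz i h)
              | exact pow_ne_zero _ h
          · simp only [p, q, if_neg h]
            simp)
      refine ⟨g, φ.injective (funext fun i => ?_)⟩
      change φ (ρ g y) i = _
      rw [hφ]
      by_cases h : φ y i ≠ 0
      · have := hg i
        simp only [t, if_pos h, dif_pos h] at this
        rw [this]
        simp [h]
      · push Not at h
        rw [h, h2 i h, mul_zero]
  change IsClosed (orbit ρ y)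
  rw [horb]
  refine IsClosed.inter ?_ (IsClosed.inter (isClosed_biInter fun i _ => ?_)
    (isClosed_biInter fun pq _ => ?_))
  · exact isClosed_eq_zero (f := fun z => ∏ i, φ z i ^ a i - ∏ i, φ y i ^ a i)
      (sub_mem (prod_pow_mem_polynomialFunctions φ a) (Subalgebra.algebraMap_mem _ _))
  · exact isClosed_eq_zero (f := fun z => φ z i)
      (polynomialFunctions_linear ((LinearMap.proj i).comp φ.toLinearMap))
  · exact isClosed_eq_zero (f := fun z => (∏ i, φ z i ^ pq.1 i) * ∏ i, φ y i ^ pq.2 i -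
          (∏ i, φ z i ^ pq.2 i) * ∏ i, φ y i ^ pq.1 i)
      (sub_mem (mul_mem (prod_pow_mem_polynomialFunctions φ _) (Subalgebra.algebraMap_mem _ _))
        (mul_mem (prod_pow_mem_polynomialFunctions φ _) (Subalgebra.algebraMap_mem _ _)))

/-- Relations with nonnegative exponents supported in `s` that together involve all of `s` add up
to a relation with support `s`. -/
theorem exists_relation_support_eq {X : Type*} [CommGroup X] (ψ : ι → X) (s : Set ι)
    (h : ∀ j ∈ s, ∃ a : ι → ℕ, ∏ i, ψ i ^ a i = 1 ∧ (∀ i, a i ≠ 0 → i ∈ s) ∧ a j ≠ 0) :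
    ∃ a : ι → ℕ, ∏ i, ψ i ^ a i = 1 ∧ ∀ i, a i ≠ 0 ↔ i ∈ s := by
  classical
  choose! a h1 h2 h3 using h
  refine ⟨fun i => ∑ j with j ∈ s, a j i, ?_, fun i => ⟨fun hi => ?_, fun hi => ?_⟩⟩
  · simp only [← Finset.prod_pow_eq_pow_sum]
    rw [Finset.prod_comm]
    exact Finset.prod_eq_one fun j hj => h1 j (Finset.mem_filter.1 hj).2
  · obtain ⟨j, hj, hne⟩ := Finset.exists_ne_zero_of_sum_ne_zero hi
    exact h2 j (Finset.mem_filter.1 hj).2 i hne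
  · intro h0
    exact h3 i hi (Finset.sum_eq_zero_iff.1 h0 i (by simpa using hi))

/-- If the orbit of `u` is closed, then each coordinate that does not vanish at `u` is invertible
on the orbit by the Nullstellensatz, so by the linear independence of characters the inverse of its
weight is a monomial in the weights occurring in `u`. -/
theorem IsWeightCoord.exists_relation (hφ : IsWeightCoord ρ φ ψ) (u : W)
    (hu : HasClosedOrbit ρ u) :
    ∃ a : ι → ℕ, ∏ i, ψ i ^ a i = 1 ∧ ∀ i, a i ≠ 0 ↔ φ u i ≠ 0 := by
  classical
  refine exists_relation_support_eq ψ {i | φ u i ≠ 0} fun j hj => ?_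
  let J := MvPolynomial.vanishingIdeal ℂ (φ '' orbit ρ u)
  have hJ : J ⊔ Ideal.span {MvPolynomial.X j} = ⊤ := by
    have h0 : MvPolynomial.zeroLocus ℂ (J ⊔ Ideal.span {MvPolynomial.X j}) = ∅ := by
      refine Set.eq_empty_of_forall_notMem fun z hz => ?_
      have h1 : φ.symm z ∈ orbit ρ u := by
        by_contra hcon
        obtain ⟨f, hf, hfz, hfO⟩ := exists_ne_zero_of_notMem hu hcon
        obtain ⟨p, hp⟩ := exists_mvPolynomial_eq φ hf
        have hpJ : p ∈ J := by
          rintro _ ⟨w, hw, rfl⟩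
          rw [MvPolynomial.aeval_eq_eval, ← hp, hfO w hw]
        have := hz p (Ideal.mem_sup_left hpJ)
        rw [MvPolynomial.aeval_eq_eval] at this
        exact hfz (by rw [hp, LinearEquiv.apply_symm_apply, this])
      obtain ⟨g, hg⟩ := h1
      have h2 := hz (MvPolynomial.X j) (Ideal.mem_sup_right (Ideal.mem_span_singleton_self _))
      have h3 : φ (ρ g u) j = 0 := by
        change ρ g u = _ at hg
        rw [hg, LinearEquiv.apply_symm_apply]
        simpa using h2
      rw [hφ] at h3
      exact mul_ne_zero (Units.ne_zero _) hj h3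
    have h1 := MvPolynomial.vanishingIdeal_zeroLocus_eq_radical (K := ℂ)
      (J ⊔ Ideal.span {MvPolynomial.X j})
    rw [h0, MvPolynomial.vanishingIdeal_empty] at h1
    exact Ideal.radical_eq_top.1 h1.symm
  obtain ⟨q, hq, r, hr, hqr⟩ := Submodule.mem_sup.1 ((Ideal.eq_top_iff_one _).1 hJ)
  obtain ⟨r, rfl⟩ := Ideal.mem_span_singleton'.1 hr
  have h1 : ∀ g, MvPolynomial.eval (φ (ρ g u)) r * (((ψ j).1 g : ℂ) * φ u j) = 1 := by
    intro g
    have hq0 : MvPolynomial.eval (φ (ρ g u)) q = 0 := by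
      have := hq (φ (ρ g u)) ⟨_, ⟨g, rfl⟩, rfl⟩
      rwa [MvPolynomial.aeval_eq_eval] at this
    have := congrArg (MvPolynomial.eval (φ (ρ g u))) hqr
    simpa [hq0, hφ g u j] using this
  obtain ⟨d, hd, hc, hψ⟩ := exists_eq_of_sum_eq r.support
    (fun d => r.coeff d * ∏ i, φ u i ^ d i) (fun d => ∏ i, ψ i ^ d i) (ψ j)⁻¹
    (d := (φ u j)⁻¹) (inv_ne_zero hj) (by
      intro g
      have h2 := h1 g
      rw [MvPolynomial.eval_eq'] at h2
      simp only [hφ.prod_pow_apply] at h2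
      have h3 : (((ψ j)⁻¹).1 g : ℂ) = (((ψ j).1 g : ℂ))⁻¹ := by simp
      rw [h3, ← mul_inv, mul_comm (φ u j), ← eq_inv_of_mul_eq_one_left h2]
      exact Finset.sum_congr rfl fun d _ => by ring)
  refine ⟨fun i => d i + if i = j then 1 else 0, ?_, fun i hi => ?_, by simp⟩
  · simp only [pow_add, Finset.prod_mul_distrib, hψ]
    simp
  · by_cases hij : i = j
    · exact hij ▸ hj
    · simp only [hij, if_false, add_zero] at hi
      intro h0
      exact hc (mul_eq_zero_of_right _ (Finset.prod_eq_zero (Finset.mem_univ i)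
        (by rw [h0, zero_pow hi])))

/-- Every fibre of the quotient map contains a closed orbit: it is obtained from a point `x` of
the fibre by keeping the coordinates that occur in an invariant monomial not vanishing at `x`. -/
theorem IsWeightCoord.exists_hasClosedOrbit (hG : IsReductive G) (hφ : IsWeightCoord ρ φ ψ)
    (x : W) : ∃ y : W, (∀ f ∈ invariantFunctions ρ, f x = f y) ∧ HasClosedOrbit ρ y := by
  classical
  let s : Set ι := {j | ∃ a : ι → ℕ, ∏ i, ψ i ^ a i = 1 ∧ (∀ i, a i ≠ 0 → φ x i ≠ 0) ∧ a j ≠ 0}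
  obtain ⟨a, ha, has⟩ := exists_relation_support_eq ψ s (by
    rintro j ⟨a, ha, hax, haj⟩
    exact ⟨a, ha, fun i hi => ⟨a, ha, hax, hi⟩, haj⟩)
  let y : W := φ.symm fun i => if i ∈ s then φ x i else 0
  have hy : ∀ i, φ y i = if i ∈ s then φ x i else 0 := fun i => by
    simp only [y, LinearEquiv.apply_symm_apply]
  have hsx : ∀ i ∈ s, φ x i ≠ 0 := by
    rintro i ⟨a, -, hax, hai⟩
    exact hax i hai
  refine ⟨y, ?_, hφ.hasClosedOrbit hG y a ha fun i => ?_⟩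
  · intro f hf
    obtain ⟨p, hp⟩ := exists_mvPolynomial_eq φ hf.1
    -- the difference of the two sides, as a combination of characters
    have h1 : ∀ g, ∑ d ∈ p.support, (p.coeff d * (∏ i, φ x i ^ d i - ∏ i, φ y i ^ d i)) *
        ((∏ i, ψ i ^ d i : regularCharacters G).1 g : ℂ) = f x - f y := by
      intro g
      rw [← hf.2 g x, ← hf.2 g y, hp, hp, MvPolynomial.eval_eq', MvPolynomial.eval_eq',
        ← Finset.sum_sub_distrib]
      refine Finset.sum_congr rfl fun d _ => ?_
      rw [hφ.prod_pow_apply, hφ.prod_pow_apply]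
      ring
    by_contra hne
    obtain ⟨d, -, hc, hd⟩ := exists_eq_of_sum_eq p.support _ (fun d => ∏ i, ψ i ^ d i) 1
      (sub_ne_zero.2 hne) fun g => (h1 g).trans (by simp)
    refine hc (mul_eq_zero_of_right _ (sub_eq_zero.2 ?_))
    by_cases hdx : ∀ i, d i ≠ 0 → φ x i ≠ 0
    · refine Finset.prod_congr rfl fun i _ => ?_
      by_cases hdi : d i = 0
      · simp [hdi]
      · rw [hy, if_pos ⟨d, hd, hdx, hdi⟩]
    · push Not at hdx
      obtain ⟨i, hdi, hxi⟩ := hdx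
      have hyi : φ y i = 0 := by rw [hy, hxi, ite_self]
      rw [Finset.prod_eq_zero (Finset.mem_univ i) (by rw [hxi, zero_pow hdi]),
        Finset.prod_eq_zero (Finset.mem_univ i) (by rw [hyi, zero_pow hdi])]
  · rw [has, hy]
    by_cases hi : i ∈ s
    · simp [hi, hsx i hi]
    · simp [hi]

theorem prod_pow_ne_zero_iff {a : ι → ℕ} {x : ι → ℂ} :
    ∏ i, x i ^ a i ≠ 0 ↔ ∀ i, a i ≠ 0 → x i ≠ 0 := by
  rw [Finset.prod_ne_zero_iff]
  refine ⟨fun h i hi h0 => h i (Finset.mem_univ i) (by rw [h0, zero_pow hi]), fun h i _ => ?_⟩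
  by_cases hi : a i = 0
  · simp [hi]
  · exact pow_ne_zero _ (h i hi)

theorem IsWeightCoord.isStable (hG : IsReductive G) (hφ : IsWeightCoord ρ φ ψ)
    (a : ι → ℕ) (ha : ∏ i, ψ i ^ a i = 1) (hpos : ∀ i, a i ≠ 0) : IsStable ρ := by
  refine ⟨_, isOpen_ne_zero (prod_pow_mem_polynomialFunctions φ a), ⟨φ.symm 1, by simp⟩,
    fun v hv => hφ.hasClosedOrbit hG v a ha fun i => ?_⟩
  exact iff_of_true (hpos i) (prod_pow_ne_zero_iff.1 hv i (hpos i))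

/-- If all weights are trivial exactly on `H` and satisfy a relation with positive exponents, then
`H` is the principal isotropy group. -/
theorem IsWeightCoord.isPrincipalIsotropy (hG : IsReductive G) (hφ : IsWeightCoord ρ φ ψ)
    (a : ι → ℕ) (ha : ∏ i, ψ i ^ a i = 1) (hpos : ∀ i, a i ≠ 0) (H : Subgroup G)
    (hH : ∀ g, g ∈ H ↔ ∀ i, (ψ i).1 g = 1) : IsPrincipalIsotropy ρ H := by
  have hconj : ∀ g : G, H.map (MulAut.conj g).toMonoidHom = H := by
    intro g
    have : (MulAut.conj g).toMonoidHom = MonoidHom.id G := by ext; simp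
    rw [this, Subgroup.map_id]
  have hle : ∀ y, H ≤ isotropy ρ y := fun y g hg =>
    (hφ.mem_isotropy_iff y g).2 fun i _ => (hH g).1 hg i
  let _ := zariskiTopology (invariantFunctions ρ)
  constructor
  · refine isOpen_iff_forall_mem_open.2 ?_
    rintro x ⟨y, hxy, hy, g, hg⟩
    rw [hconj] at hg
    obtain ⟨b, hb, hby⟩ := hφ.exists_relation y hy
    have hbinv := hφ.prod_pow_mem_invariantFunctions b hb
    refine ⟨_, ?_, isOpen_ne_zero hbinv, ?_⟩
    · intro x' hx'
      obtain ⟨y', hxy', hy'⟩ := hφ.exists_hasClosedOrbit hG x'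
      refine ⟨y', hxy', hy', 1, ?_⟩
      rw [hconj]
      refine le_antisymm (fun k hk => ?_) (hle y')
      rw [← hg, hφ.mem_isotropy_iff]
      intro i hi
      have h1 : ∏ i, φ y' i ^ b i ≠ 0 := by
        rw [← hxy' _ hbinv]; exact hx'
      exact (hφ.mem_isotropy_iff y' k).1 hk i (prod_pow_ne_zero_iff.1 h1 i ((hby i).2 hi))
    · change ∏ i, φ x i ^ b i ≠ 0
      rw [hxy _ hbinv]
      exact prod_pow_ne_zero_iff.2 fun i hi => (hby i).1 hi
  · refine (zariskiTopology_isBasis _).dense_iff.2 ?_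
    rintro _ ⟨f, hf, rfl⟩ ⟨p, hp⟩
    have h1 : ∏ i, φ (φ.symm 1) i ^ a i ≠ 0 := by simp
    obtain ⟨s, hs1, hs2⟩ :=
      exists_line_ne_zero hf.1 (prod_pow_mem_polynomialFunctions φ a) hp h1
    refine ⟨_, hs1, p + s • (φ.symm 1 - p), fun _ _ => rfl, ?_, 1, ?_⟩
    · exact hφ.hasClosedOrbit hG _ a ha fun i =>
        iff_of_true (hpos i) (prod_pow_ne_zero_iff.1 hs2 i (hpos i))
    · rw [hconj]
      refine le_antisymm (fun k hk => (hH k).2 fun i => ?_) (hle _)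
      exact (hφ.mem_isotropy_iff _ k).1 hk i (prod_pow_ne_zero_iff.1 hs2 i (hpos i))

end Orbits

/-! ### Dimension and modularity -/

section Dimension

theorem zariskiDim_mono {X : Type*} (A : Subalgebra ℂ (X → ℂ)) {S T : Set X} (h : S ⊆ T) :
    zariskiDim A S ≤ zariskiDim A T := by
  let _ := zariskiTopology A
  have : Topology.IsInducing (Set.inclusion h) :=
    ⟨by rw [instTopologicalSpaceSubtype, instTopologicalSpaceSubtype, induced_compose]; rfl⟩
  exact this.topologicalKrullDim_le

/-- An infinite `T₁` space whose proper closed subsets are finite has dimension one. -/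
theorem topologicalKrullDim_eq_one_of_finite {Y : Type*} [TopologicalSpace Y] [T1Space Y]
    [Infinite Y] (h : ∀ C : Set Y, IsClosed C → C ≠ Set.univ → C.Finite) :
    topologicalKrullDim Y = 1 := by
  refine le_antisymm (Order.krullDim_le_one_iff.2 fun x => ?_) ?_
  · by_cases hx : (x : Set Y) = Set.univ
    · refine Or.inr fun y _ => ?_
      change (y : Set Y) ⊆ x
      rw [hx]
      exact Set.subset_univ _
    · refine Or.inl fun y hy => ?_
      have hfin := h x x.isClosed hx
      have hsub : (x : Set Y).Subsingleton := by
        intro a ha b hb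
        by_contra hab
        rcases isPreirreducible_iff_isClosed_union_isClosed.1 x.isIrreducible.2 {a}
          ((x : Set Y) \ {a}) isClosed_singleton hfin.sdiff.isClosed
          (fun c hc => by by_cases hca : c = a <;> simp_all) with h1 | h1
        · exact hab (h1 hb).symm
        · exact (h1 ha).2 rfl
      obtain ⟨c, hc⟩ := y.isIrreducible.1
      intro a ha
      have hcx : c ∈ (x : Set Y) := hy hc
      rwa [hsub ha hcx]
  · let a : Y := Classical.arbitrary Y
    have huniv : IsIrreducible (Set.univ : Set Y) := by
      refine ⟨Set.univ_nonempty, isPreirreducible_iff_isClosed_union_isClosed.2 ?_⟩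
      intro C D hC hD hCD
      by_contra! hcon
      exact Set.infinite_univ (((h C hC fun h => hcon.1 h.ge).union
        (h D hD fun h => hcon.2 h.ge)).subset hCD)
    have hlt : (⟨{a}, isIrreducible_singleton, isClosed_singleton⟩ :
        TopologicalSpace.IrreducibleCloseds Y) < ⟨Set.univ, huniv, isClosed_univ⟩ := by
      refine lt_of_le_of_ne (Set.subset_univ _) fun heq => ?_
      have h1 : ({a} : Set Y) = Set.univ :=
        congrArg (fun C : TopologicalSpace.IrreducibleCloseds Y => (C : Set Y)) heq
      exact Set.infinite_univ (h1 ▸ Set.finite_singleton a)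
    have := Order.LTSeries.length_le_krullDim
      ((RelSeries.singleton _ _).snoc _ hlt : LTSeries (TopologicalSpace.IrreducibleCloseds Y))
    simpa [topologicalKrullDim] using! this

/-- The points of a coordinate hyperplane whose remaining coordinates do not vanish form a set of
dimension at least `dim W - 1`: requiring more and more of these coordinates to be `1` gives a
chain of irreducible closed subsets. -/
theorem le_zariskiDim_hyperplane {ι W : Type*} [Fintype ι] [AddCommGroup W] [Module ℂ W]
    (φ : W ≃ₗ[ℂ] (ι → ℂ)) (i₀ : ι) {n : ℕ} (hn : Fintype.card ι = n + 1) :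
    (n : WithBot ℕ∞) ≤ zariskiDim (polynomialFunctions W)
      {v | φ v i₀ = 0 ∧ ∀ j, j ≠ i₀ → φ v j ≠ 0} := by
  classical
  let _ := zariskiTopology (polynomialFunctions W)
  set T : Set W := {v | φ v i₀ = 0 ∧ ∀ j, j ≠ i₀ → φ v j ≠ 0}
  have hcard : Fintype.card {j // j ≠ i₀} = n := by
    rw [Fintype.card_subtype_compl, hn, Fintype.card_subtype_eq, Nat.add_sub_cancel]
  let e : Fin n ≃ {j // j ≠ i₀} := (Fintype.equivFinOfCardEq hcard).symm
  let C : Fin (n + 1) → Set T := fun k => {v | ∀ l : Fin n, (k : ℕ) ≤ l → φ v.1 (e l).1 = 1}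
  have hlin : ∀ i, (fun w => φ w i) ∈ polynomialFunctions W := fun i =>
    polynomialFunctions_linear ((LinearMap.proj i).comp φ.toLinearMap)
  have hclosed : ∀ k, IsClosed (C k) := by
    intro k
    have : C k = ⋂ l ∈ {l : Fin n | (k : ℕ) ≤ l},
        (Subtype.val : T → W) ⁻¹' {w | φ w (e l).1 - 1 = 0} := by
      ext v
      simp [C, sub_eq_zero]
    rw [this]
    refine isClosed_biInter fun l _ => IsClosed.preimage continuous_subtype_val ?_
    exact isClosed_eq_zero (f := fun w => φ w (e l).1 - 1) (sub_mem (hlin _) (one_mem _))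
  -- `pt k` lies in `C k'` if and only if `k' > k` or `k = n`
  let pt : Fin (n + 1) → W := fun k =>
    φ.symm fun i => if h : i = i₀ then 0 else if (e.symm ⟨i, h⟩ : ℕ) = k then 2 else 1
  have hpt0 : ∀ k, φ (pt k) i₀ = 0 := fun k => by simp [pt]
  have hpt : ∀ k l, φ (pt k) (e l).1 = if (l : ℕ) = k then 2 else 1 := fun k l => by
    simp only [pt, LinearEquiv.apply_symm_apply, dif_neg (e l).2]
    simp
  have hptT : ∀ k, pt k ∈ T := by
    refine fun k => ⟨hpt0 k, fun j hj => ?_⟩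
    have := hpt k (e.symm ⟨j, hj⟩)
    rw [Equiv.apply_symm_apply] at this
    rw [this]
    split_ifs <;> norm_num
  have hirr : ∀ k, IsIrreducible (C k) := by
    intro k
    refine ⟨⟨⟨pt (Fin.last n), hptT _⟩, fun l _ => ?_⟩, ?_⟩
    · rw [hpt, if_neg]
      simpa using l.2.ne
    · -- join two points by a line, and keep away from the coordinate hyperplanes
      rintro _ _ ⟨U₁, hU₁, rfl⟩ ⟨U₂, hU₂, rfl⟩ ⟨⟨p, hpT⟩, hpC, hpU⟩ ⟨⟨q, hqT⟩, hqC, hqU⟩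
      obtain ⟨_, ⟨f, hf, rfl⟩, hfp, hfU⟩ :=
        (zariskiTopology_isBasis _).exists_subset_of_mem_open (a := p) hpU hU₁
      obtain ⟨_, ⟨h, hh, rfl⟩, hhq, hhU⟩ :=
        (zariskiTopology_isBasis _).exists_subset_of_mem_open (a := q) hqU hU₂
      let a : ι → ℕ := fun i => if i = i₀ then 0 else 1
      have ha : ∀ v ∈ T, ∏ i, φ v i ^ a i ≠ 0 := fun v hv =>
        prod_pow_ne_zero_iff.2 fun i hi => hv.2 i fun h => hi (by simp [a, h])
      obtain ⟨s, hs1, hs2⟩ := exists_line_ne_zero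
        (mul_mem hf (prod_pow_mem_polynomialFunctions φ a)) hh
        (p := p) (q := q) (mul_ne_zero hfp (ha p hpT)) hhq
      have hz : p + s • (q - p) ∈ T := by
        refine ⟨by simp [hpT.1, hqT.1], fun j hj => ?_⟩
        exact prod_pow_ne_zero_iff.1 (right_ne_zero_of_mul hs1) j (by simp [a, hj])
      refine ⟨⟨_, hz⟩, fun l hl => ?_, hfU (left_ne_zero_of_mul hs1), hhU hs2⟩
      have h1 : φ p (e l).1 = 1 := hpC l hl
      have h2 : φ q (e l).1 = 1 := hqC l hl
      simp [h1, h2]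
  let F : Fin (n + 1) → TopologicalSpace.IrreducibleCloseds T := fun k =>
    ⟨C k, hirr k, hclosed k⟩
  have hF : StrictMono F := by
    intro k k' hk
    refine lt_of_le_of_ne (fun v hv l hl => hv l (le_trans (le_of_lt hk) hl)) fun heq => ?_
    have h1 : C k = C k' :=
      congrArg (fun D : TopologicalSpace.IrreducibleCloseds T => (D : Set T)) heq
    have hkn : (k : ℕ) < n := lt_of_lt_of_le hk (Nat.le_of_lt_succ k'.2)
    have h2 : (⟨pt k, hptT k⟩ : T) ∈ C k' := by
      intro l hl
      change φ (pt k) (e l).1 = 1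
      rw [hpt, if_neg (by have : (k : ℕ) < k' := hk; omega)]
    rw [← h1] at h2
    have h3 : φ (pt k) (e ⟨k, hkn⟩).1 = 1 := h2 ⟨k, hkn⟩ le_rfl
    rw [hpt, if_pos rfl] at h3
    norm_num at h3
  exact Order.LTSeries.length_le_krullDim (LTSeries.mk n F hF)

variable {G : Type*} [CommGroup G] [AffineAlgebraicGroup G]

/-- A subgroup on which some character `χ` is bijective onto `ℂˣ`, and every other character is a
power of `χ`, has dimension one. -/
theorem zariskiDim_eq_one (hG : IsReductive G) (K : Subgroup G) (χ : regularCharacters G)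
    (hsurj : ∀ t : ℂˣ, ∃ g ∈ K, χ.1 g = t)
    (hinj : ∀ g ∈ K, ∀ h ∈ K, χ.1 g = χ.1 h → g = h)
    (hpow : ∀ η : regularCharacters G, ∃ m : ℤ, ∀ g ∈ K, η.1 g = χ.1 g ^ m) :
    zariskiDim (AffineAlgebraicGroup.regular (G := G)) (K : Set G) = 1 := by
  -- regular functions are Laurent polynomials in `χ` on `K`
  have hlaurent : ∀ f : AffineAlgebraicGroup.regular (G := G), ∃ (P : Polynomial ℂ) (N : ℕ),
      ∀ g ∈ K, f.1 g * (χ.1 g : ℂ) ^ N = P.eval (χ.1 g : ℂ) := by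
    intro f
    have hf : f ∈ Submodule.span ℂ (Set.range (charFun : regularCharacters G → _)) := by
      rw [span_charFun hG]; trivial
    induction hf using Submodule.span_induction with
    | mem f hf =>
      obtain ⟨η, rfl⟩ := hf
      obtain ⟨m, hm⟩ := hpow η
      refine ⟨Polynomial.X ^ m.toNat, (-m).toNat, fun g hg => ?_⟩
      rw [charFun_apply, hm g hg, Units.val_zpow_eq_zpow_val, ← zpow_natCast,
        ← zpow_add₀ (Units.ne_zero _), Polynomial.eval_pow, Polynomial.eval_X, ← zpow_natCast]
      congr 1
      omega
    | zero => exact ⟨0, 0, fun g _ => by simp⟩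
    | add f f' _ _ hf hf' =>
      obtain ⟨P, N, h⟩ := hf
      obtain ⟨P', N', h'⟩ := hf'
      refine ⟨P * Polynomial.X ^ N' + P' * Polynomial.X ^ N, N + N', fun g hg => ?_⟩
      simp only [Polynomial.eval_add, Polynomial.eval_mul, Polynomial.eval_pow,
        Polynomial.eval_X, ← h g hg, ← h' g hg]
      change (f.1 g + f'.1 g) * _ = _
      ring
    | smul c f _ hf =>
      obtain ⟨P, N, h⟩ := hf
      refine ⟨Polynomial.C c * P, N, fun g hg => ?_⟩
      rw [Polynomial.eval_mul, Polynomial.eval_C, ← h g hg]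
      change c * f.1 g * _ = _
      ring
  let _ := zariskiTopology (AffineAlgebraicGroup.regular (G := G))
  have hT1 : T1Space (K : Set G) := ⟨fun g => by
    have : ({g} : Set (K : Set G)) = Subtype.val ⁻¹' {h | (χ.1 h : ℂ) - χ.1 g.1 = 0} := by
      ext h
      simp only [Set.mem_singleton_iff, Set.mem_preimage, Set.mem_ofPred_eq, sub_eq_zero]
      exact ⟨fun h => h ▸ rfl, fun h' => Subtype.ext (hinj _ h.2 _ g.2 (Units.ext h'))⟩
    rw [this]
    refine IsClosed.preimage continuous_subtype_val ?_
    exact isClosed_eq_zero (f := fun h => (χ.1 h : ℂ) - χ.1 g.1)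
      (sub_mem χ.2 (Subalgebra.algebraMap_mem _ _))⟩
  have hinf : Infinite (K : Set G) := by
    have : Infinite ℂˣ :=
      Infinite.of_injective (fun n : ℕ => Units.mk0 ((n : ℂ) + 1) (Nat.cast_add_one_ne_zero n))
        fun m n h => by simpa using congrArg Units.val h
    exact Infinite.of_surjective (fun g : (K : Set G) => χ.1 g.1) fun t =>
      (hsurj t).elim fun g hg => ⟨⟨g, hg.1⟩, hg.2⟩
  refine topologicalKrullDim_eq_one_of_finite fun C hC hne => ?_
  obtain ⟨D, hD, rfl⟩ := isClosed_induced_iff.1 hC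
  obtain ⟨k, hk⟩ := (Set.ne_univ_iff_exists_notMem _).1 hne
  obtain ⟨f, hf, hfk, hfD⟩ := exists_ne_zero_of_notMem hD (x := k.1) hk
  obtain ⟨P, N, hP⟩ := hlaurent ⟨f, hf⟩
  have hP0 : P ≠ 0 := by
    rintro rfl
    have := hP k.1 k.2
    rw [Polynomial.eval_zero] at this
    exact mul_ne_zero hfk (pow_ne_zero _ (Units.ne_zero _)) this
  refine Set.Finite.of_injOn (f := fun g : (K : Set G) => (χ.1 g.1 : ℂ)) (t := {z | P.IsRoot z})
    ?_ ?_ (Polynomial.finite_setOfPred_isRoot hP0)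
  · intro g hg
    have h1 := hP g.1 g.2
    change f g.1 * _ = _ at h1
    rw [hfD g.1 hg, zero_mul] at h1
    exact h1.symm
  · intro g _ h _ hgh
    exact Subtype.ext (hinj _ g.2 _ h.2 (Units.ext hgh))

/-- In a faithful `1`-modular representation every weight occurs in a relation: otherwise the
kernel of the remaining weights would be one-dimensional, and would be the isotropy group of the
generic points of a hyperplane. -/
theorem IsWeightCoord.exists_relation_of_isModular {ι W : Type*} [Fintype ι] [AddCommGroup W]
    [Module ℂ W] {ρ : Representation ℂ G W} {φ : W ≃ₗ[ℂ] (ι → ℂ)}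
    {χ : ι → regularCharacters G} (hG : IsReductive G) (hφ : IsWeightCoord ρ φ χ)
    (hfaithful : Function.Injective ρ) (hmod : IsModular 1 ρ) (i₀ : ι) :
    ∃ m : ι → ℤ, ∏ i, χ i ^ m i = 1 ∧ m i₀ ≠ 0 := by
  classical
  by_contra! hcon
  let K : Subgroup G := isotropy ρ (φ.symm fun i => if i = i₀ then 0 else 1)
  have hK : ∀ g, g ∈ K ↔ ∀ j, j ≠ i₀ → (χ j).1 g = 1 := by
    intro g
    rw [hφ.mem_isotropy_iff]
    simp
  have hiso : ∀ v, φ v i₀ = 0 ∧ (∀ j, j ≠ i₀ → φ v j ≠ 0) → isotropy ρ v = K := by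
    rintro v ⟨h0, h1⟩
    ext g
    rw [hK, hφ.mem_isotropy_iff]
    exact forall_congr' fun j => ⟨fun h hj => h (h1 j hj), fun h hj => h fun hj0 => hj (hj0 ▸ h0)⟩
  have hker : ∀ g : G, (∀ i, (χ i).1 g = 1) → g = 1 := by
    intro g hg
    apply hfaithful
    rw [map_one]
    refine LinearMap.ext fun w => φ.injective (funext fun i => ?_)
    rw [hφ, hg]
    simp
  have hdim : zariskiDim (AffineAlgebraicGroup.regular (G := G)) (K : Set G) = 1 := by
    refine zariskiDim_eq_one hG K (χ i₀) (fun t => ?_) (fun g hg h hh hgh => ?_) (fun η => ?_)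
    · obtain ⟨g, hg⟩ := exists_forall_char_eq hG χ (fun i => if i = i₀ then t else 1) (by
        intro m hm
        refine Finset.prod_eq_one fun i _ => ?_
        by_cases hi : i = i₀
        · rw [hi, hcon m hm, zpow_zero]
        · rw [if_neg hi, one_zpow])
      exact ⟨g, (hK g).2 fun j hj => by rw [hg, if_neg hj], by rw [hg, if_pos rfl]⟩
    · have := hker (g * h⁻¹) fun i => by
        rw [map_mul, map_inv, mul_inv_eq_one]
        by_cases hi : i = i₀
        · rw [hi, hgh]
        · rw [(hK g).1 hg i hi, (hK h).1 hh i hi]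
      exact mul_inv_eq_one.1 this
    · obtain ⟨m, rfl⟩ := exists_eq_prod_zpow_of_forall_eq_one hG χ η fun g hg => by
        rw [hker g hg, map_one]
      refine ⟨m i₀, fun g hg => ?_⟩
      have h1 : (∏ i, χ i ^ m i : regularCharacters G).1 g = ∏ i, (χ i).1 g ^ m i := by simp
      rw [h1]
      refine Finset.prod_eq_single i₀ (fun j _ hj => ?_) (by simp)
      rw [(hK g).1 hg j hj, one_zpow]
  obtain ⟨n, hn⟩ : ∃ n, Fintype.card ι = n + 1 :=
    ⟨Fintype.card ι - 1, (Nat.succ_pred_eq_of_pos (Fintype.card_pos_iff.2 ⟨i₀⟩)).symm⟩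
  have hfin : Module.finrank ℂ W = n + 1 := by
    rw [φ.finrank_eq, Module.finrank_fintype_fun_eq_card, hn]
  -- `V_(1)` contains the generic points of the hyperplane, so its codimension is at most one
  have h1 := hmod 1 le_rfl (by
    rw [Nat.cast_one, ← hdim]
    exact zariskiDim_mono _ (Set.subset_univ _))
  have h2 := (le_zariskiDim_hyperplane φ i₀ hn).trans (zariskiDim_mono _
    (T := {v | zariskiDim (AffineAlgebraicGroup.regular (G := G)) (isotropy ρ v : Set G) =
      ((1 : ℕ) : WithBot ℕ∞)}) fun v hv => by
        change zariskiDim _ (isotropy ρ v : Set G) = _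
        rw [hiso v hv, hdim, Nat.cast_one])
  rw [hfin] at h1
  have h3 : ((n + (1 + 1) : ℕ) : WithBot ℕ∞) ≤ ((n + 1 : ℕ) : WithBot ℕ∞) := by
    refine le_trans ?_ h1
    rw [Nat.cast_add n]
    gcongr
  have h4 : n + (1 + 1) ≤ n + 1 := by exact_mod_cast h3
  omega

end Dimension

/-! ### Combining relations -/

section Combining

variable {ι : Type*} [Fintype ι]

/-- A large multiple of `m` dominates `m'`: the sum has the signs of `m` wherever `m` is nonzero. -/
theorem exists_dominating_multiple (m m' : ι → ℤ) :
    ∃ N : ℤ, ∀ i, m i ≠ 0 → 0 < (m' i + N * m i) * m i := by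
  refine ⟨1 + ∑ j, |m' j|, fun i hi => ?_⟩
  have h1 : |m' i| ≤ ∑ j, |m' j| :=
    Finset.single_le_sum (f := fun j => |m' j|) (fun j _ => abs_nonneg _) (Finset.mem_univ i)
  have h2 : 1 ≤ |m i| := Int.one_le_abs hi
  have h3 : -(|m' i| * |m i|) ≤ m' i * m i := by
    rw [← abs_mul]; exact neg_abs_le _
  have h4 : m i * m i = |m i| * |m i| := (abs_mul_abs_self _).symm
  have h5 : |m' i| * |m i| ≤ (∑ j, |m' j|) * (|m i| * |m i|) :=
    mul_le_mul h1 (le_mul_of_one_le_left (abs_nonneg _) h2) (abs_nonneg _) ((abs_nonneg _).trans h1)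
  have h6 : 0 < |m i| * |m i| := by positivity
  rw [add_mul, mul_assoc, h4]
  linarith

theorem prod_zpow_add_mul {X : Type*} [CommGroup X] (χ : ι → X) {m m' : ι → ℤ} (N : ℤ)
    (h : ∏ i, χ i ^ m i = 1) (h' : ∏ i, χ i ^ m' i = 1) :
    ∏ i, χ i ^ (m' i + N * m i) = 1 := by
  simp only [zpow_add, mul_comm N, zpow_mul, Finset.prod_mul_distrib, Finset.prod_zpow, h, h',
    one_zpow, mul_one]

/-- If every member of `s` occurs in a relation supported in `s`, then some relation has support
exactly `s`. -/
theorem exists_zpow_relation_support_eq {X : Type*} [CommGroup X] (χ : ι → X) (s : Set ι)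
    (h : ∀ j ∈ s, ∃ m : ι → ℤ, ∏ i, χ i ^ m i = 1 ∧ (∀ i, m i ≠ 0 → i ∈ s) ∧ m j ≠ 0) :
    ∃ m : ι → ℤ, ∏ i, χ i ^ m i = 1 ∧ ∀ i, m i ≠ 0 ↔ i ∈ s := by
  classical
  have key : ∀ F : Finset ι, (∀ j ∈ F, j ∈ s) → ∃ m : ι → ℤ, ∏ i, χ i ^ m i = 1 ∧
      (∀ i, m i ≠ 0 → i ∈ s) ∧ ∀ j ∈ F, m j ≠ 0 := by
    intro F
    induction F using Finset.induction_on with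
    | empty => exact fun _ => ⟨0, by simp, by simp, by simp⟩
    | insert j F _ ih =>
      intro hF
      obtain ⟨m, h1, h2, h3⟩ := ih fun i hi => hF i (Finset.mem_insert_of_mem hi)
      obtain ⟨m', h1', h2', h3'⟩ := h j (hF j (Finset.mem_insert_self _ _))
      obtain ⟨N, hN⟩ := exists_dominating_multiple m m'
      refine ⟨fun i => m' i + N * m i, prod_zpow_add_mul χ N h1 h1', fun i hi => ?_, ?_⟩
      · by_cases hm : m i = 0
        · exact h2' i (by simpa [hm] using hi)
        · exact h2 i hm
      · intro i hi
        by_cases hm : m i = 0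
        · rcases Finset.mem_insert.1 hi with rfl | hi
          · simpa [hm] using h3'
          · exact absurd hm (h3 i hi)
        · exact left_ne_zero_of_mul (hN i hm).ne'
  obtain ⟨m, h1, h2, h3⟩ := key (Finset.univ.filter (· ∈ s)) (by simp)
  exact ⟨m, h1, fun i => ⟨h2 i, fun hi => h3 i (by simpa using hi)⟩⟩

end Combining

/-! ### The module `V ⊕ V*` -/

section Coordinates

variable {G : Type*} [CommGroup G] [AffineAlgebraicGroup G]

/-- A subrepresentation defined by the vanishing of some weight coordinates inherits the
others. -/
theorem IsWeightCoord.restrict {κ ι W : Type*} [AddCommGroup W] [Module ℂ W]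
    {σ : Representation ℂ G W} {Φ : W ≃ₗ[ℂ] (κ → ℂ)} {ψ : κ → regularCharacters G}
    (hΦ : IsWeightCoord σ Φ ψ) (S : Subrepresentation σ) (s : ι → κ) (hs : Function.Injective s)
    (hS : ∀ w, w ∈ S.toSubmodule ↔ ∀ k, k ∉ Set.range s → Φ w k = 0) :
    ∃ φ : S.toSubmodule ≃ₗ[ℂ] (ι → ℂ), (∀ w i, φ w i = Φ w.1 (s i)) ∧
      IsWeightCoord S.toRepresentation φ fun i => ψ (s i) := by
  let L : S.toSubmodule →ₗ[ℂ] (ι → ℂ) :=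
    LinearMap.funLeft ℂ ℂ s ∘ₗ Φ.toLinearMap ∘ₗ S.toSubmodule.subtype
  have hL : ∀ w i, L w i = Φ w.1 (s i) := fun _ _ => rfl
  have hinj : Function.Injective L := by
    refine (injective_iff_map_eq_zero L).2 fun w hw => Subtype.ext (Φ.injective ?_)
    funext k
    simp only [ZeroMemClass.coe_zero, map_zero, Pi.zero_apply]
    by_cases hk : k ∈ Set.range s
    · obtain ⟨i, rfl⟩ := hk
      rw [← hL, hw, Pi.zero_apply]
    · exact (hS w.1).1 w.2 k hk
  have hsurj : Function.Surjective L := by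
    intro x
    refine ⟨⟨Φ.symm (Function.extend s x 0), (hS _).2 fun k hk => ?_⟩, funext fun i => ?_⟩
    · rw [LinearEquiv.apply_symm_apply, Function.extend_apply' _ _ _ (by simpa using hk)]
      rfl
    · rw [hL, LinearEquiv.apply_symm_apply, hs.extend_apply]
  exact ⟨LinearEquiv.ofBijective L ⟨hinj, hsurj⟩, fun _ _ => rfl, fun g w i => hΦ g w.1 (s i)⟩

variable {V : Type*} [AddCommGroup V] [Module ℂ V] {ρ : Representation ℂ G V} {ι : Type*}
  [Fintype ι]

/-- The coordinates `(x, ξ)` on `V ⊕ V*` defined by coordinates on `V` and the dual ones. -/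
def cotangentCoord (φ : V ≃ₗ[ℂ] (ι → ℂ)) : (V × Module.Dual ℂ V) ≃ₗ[ℂ] (ι ⊕ ι → ℂ) :=
  (LinearEquiv.prodCongr φ ((Module.Basis.ofEquivFun φ).constr ℂ).symm).trans
    (LinearEquiv.sumArrowLequivProdArrow ι ι ℂ ℂ).symm

theorem cotangentCoord_inl (φ : V ≃ₗ[ℂ] (ι → ℂ)) (u : V × Module.Dual ℂ V) (i : ι) :
    cotangentCoord φ u (Sum.inl i) = φ u.1 i := rfl

theorem cotangentCoord_inr [DecidableEq ι] (φ : V ≃ₗ[ℂ] (ι → ℂ)) (u : V × Module.Dual ℂ V)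
    (i : ι) : cotangentCoord φ u (Sum.inr i) = u.2 (φ.symm (Pi.single i 1)) := by
  change u.2 (Module.Basis.ofEquivFun φ i) = _
  rw [Module.Basis.coe_ofEquivFun]

/-- The weights of `V ⊕ V*` are the weights of `V` and their inverses. -/
theorem IsWeightCoord.cotangent {φ : V ≃ₗ[ℂ] (ι → ℂ)} {χ : ι → regularCharacters G}
    (hφ : IsWeightCoord ρ φ χ) :
    IsWeightCoord (cotangentRep ρ) (cotangentCoord φ) (Sum.elim χ fun i => (χ i)⁻¹) := by
  classical
  rintro g u (i | i)
  · exact hφ g u.1 i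
  · rw [cotangentCoord_inr, cotangentCoord_inr]
    have h : ρ g⁻¹ (φ.symm (Pi.single i 1)) =
        (((χ i)⁻¹).1 g : ℂ) • φ.symm (Pi.single i 1) := by
      apply φ.injective
      funext j
      rw [hφ, map_smul, LinearEquiv.apply_symm_apply]
      rcases eq_or_ne j i with rfl | hj <;> simp [*]
    change u.2 (ρ g⁻¹ _) = _
    rw [h, map_smul]
    rfl

/-- The pairing of `V*` and `V` in coordinates. -/
theorem dual_apply_eq_sum (φ : V ≃ₗ[ℂ] (ι → ℂ)) (ξ : Module.Dual ℂ V) (x : V) :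
    ξ x = ∑ i, cotangentCoord φ (x, ξ) (Sum.inl i) * cotangentCoord φ (x, ξ) (Sum.inr i) := by
  classical
  have h : x = ∑ i, φ x i • φ.symm (Pi.single i 1) := by
    apply φ.injective
    funext j
    simp [Pi.single_apply]
  conv_lhs => rw [h]
  simp only [map_sum, map_smul, smul_eq_mul]
  exact Finset.sum_congr rfl fun i _ => by rw [cotangentCoord_inl, cotangentCoord_inr]

/-- At a point `(x, ξ)` of the shell, every weight `χ i` with `x i * ξ i ≠ 0` occurs in a relation
among such weights: otherwise some element of the Lie algebra would be zero on all of these weights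
except `χ i`, and the moment map would not vanish. -/
theorem IsWeightCoord.exists_relation_of_mem_shell (hG : IsReductive G) (hρ : IsRational ρ)
    {φ : V ≃ₗ[ℂ] (ι → ℂ)} {χ : ι → regularCharacters G} (hφ : IsWeightCoord ρ φ χ)
    {u : V × Module.Dual ℂ V} (hu : u ∈ shell ρ hρ) (j : ι)
    (hj : cotangentCoord φ u (Sum.inl j) * cotangentCoord φ u (Sum.inr j) ≠ 0) :
    ∃ m : ι → ℤ, ∏ i, χ i ^ m i = 1 ∧ (∀ i, m i ≠ 0 →
      cotangentCoord φ u (Sum.inl i) * cotangentCoord φ u (Sum.inr i) ≠ 0) ∧ m j ≠ 0 := by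
  classical
  set c : ι → ℂ := fun i => cotangentCoord φ u (Sum.inl i) * cotangentCoord φ u (Sum.inr i) with hc
  change c j ≠ 0 at hj
  by_contra! hcon
  obtain ⟨θ, hθ⟩ := exists_addHom_of_relations
    (fun i => if c i ≠ 0 then Additive.ofMul (χ i) else 0)
    (fun i => if i = j then (1 : ℂ) else 0) (by
      intro m hm
      have h1 := hcon (fun i => if c i ≠ 0 then m i else 0) (by
        refine Eq.trans (Finset.prod_congr rfl fun i _ => ?_) (congrArg Additive.toMul hm)
        by_cases hi : c i ≠ 0
        · rw [if_pos hi, if_pos hi]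
          rfl
        · rw [if_neg hi, if_neg hi, smul_zero]
          exact zpow_zero _) (fun i hi h0 => by
          change c i = 0 at h0
          simp [h0] at hi)
      simp only [if_pos hj] at h1
      refine Finset.sum_eq_zero fun i _ => ?_
      by_cases hi : i = j
      · rw [hi, h1, zero_smul]
      · rw [if_neg hi, smul_zero])
  obtain ⟨X, hX⟩ := exists_lieAlg_eq hG θ
  have h1 : (⟨matrixCoeff ρ u.2 u.1, hρ u.2 u.1⟩ : AffineAlgebraicGroup.regular (G := G)) =
      ∑ i, c i • charFun (χ i) := by
    apply Subtype.ext
    funext g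
    have h2 : matrixCoeff ρ u.2 u.1 g = ∑ i, c i * ((χ i).1 g : ℂ) := by
      rw [matrixCoeff, dual_apply_eq_sum φ]
      refine Finset.sum_congr rfl fun i _ => ?_
      rw [cotangentCoord_inl, hφ, cotangentCoord_inr]
      simp only [hc, cotangentCoord_inl, cotangentCoord_inr]
      ring
    simpa using! h2
  have h2 : X.1 ⟨matrixCoeff ρ u.2 u.1, hρ u.2 u.1⟩ = 0 := LinearMap.congr_fun hu X
  rw [h1, map_sum] at h2
  have h3 : ∀ i, X.1 (c i • charFun (χ i)) = if i = j then c j else 0 := by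
    intro i
    rw [map_smul, hX, smul_eq_mul]
    have := hθ i
    by_cases hi : c i = 0
    · rw [hi, zero_mul]
      split_ifs with h
      · exact absurd (h ▸ hi) hj
      · rfl
    · simp only [ne_eq, hi, not_false_eq_true, if_true] at this
      rw [this]
      split_ifs with h
      · rw [h, mul_one]
      · rw [mul_zero]
  simp only [h3, Finset.sum_ite_eq', Finset.mem_univ, if_true] at h2
  exact hj h2

/-- Choosing for each `i` either the coordinate `x i` or the coordinate `ξ i`, and putting the
others equal to zero, gives a Lagrangian subspace of `V ⊕ V*`. -/
theorem isLagrangian_of_section (φ : V ≃ₗ[ℂ] (ι → ℂ)) (s : ι → ι ⊕ ι)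
    (hs : ∀ i, s i = Sum.inl i ∨ s i = Sum.inr i) (L : Submodule ℂ (V × Module.Dual ℂ V))
    (hL : ∀ u, u ∈ L ↔ ∀ k, k ∉ Set.range s → cotangentCoord φ u k = 0) : IsLagrangian L := by
  classical
  have hl : ∀ i, Sum.inl i ∉ Set.range s ↔ s i = Sum.inr i := by
    intro i
    constructor
    · intro h
      exact (hs i).resolve_left fun h' => h ⟨i, h'⟩
    · rintro h ⟨j, hj⟩
      rcases hs j with h' | h' <;> rw [h'] at hj
      · rw [← Sum.inl_injective hj, h'] at h
        cases h
      · cases hj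
  have hr : ∀ i, Sum.inr i ∉ Set.range s ↔ s i = Sum.inl i := by
    intro i
    constructor
    · intro h
      exact (hs i).resolve_right fun h' => h ⟨i, h'⟩
    · rintro h ⟨j, hj⟩
      rcases hs j with h' | h' <;> rw [h'] at hj
      · cases hj
      · rw [← Sum.inr_injective hj, h'] at h
        cases h
  have hpair : ∀ u w : V × Module.Dual ℂ V, w.2 u.1 - u.2 w.1 =
      ∑ i, (cotangentCoord φ u (Sum.inl i) * cotangentCoord φ w (Sum.inr i) -
        cotangentCoord φ w (Sum.inl i) * cotangentCoord φ u (Sum.inr i)) := by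
    intro u w
    rw [dual_apply_eq_sum φ w.2, dual_apply_eq_sum φ u.2, ← Finset.sum_sub_distrib]
    exact Finset.sum_congr rfl fun i _ => by simp only [cotangentCoord_inl, cotangentCoord_inr]
  intro u
  constructor
  · intro hu w hw
    rw [hpair]
    refine Finset.sum_eq_zero fun i _ => ?_
    rcases hs i with h | h
    · rw [(hL u).1 hu _ ((hr i).2 h), (hL w).1 hw _ ((hr i).2 h)]
      ring
    · rw [(hL u).1 hu _ ((hl i).2 h), (hL w).1 hw _ ((hl i).2 h)]
      ring
  · intro h
    refine (hL u).2 fun k hk => ?_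
    -- pair `u` with the basis vector conjugate to the `k`-th one
    rcases k with i | i
    · have hi := (hl i).1 hk
      have h1 := h ((cotangentCoord φ).symm (Pi.single (Sum.inr i) 1)) ((hL _).2 fun k hk' => by
        rw [LinearEquiv.apply_symm_apply, Pi.single_eq_of_ne]
        rintro rfl
        exact hk' ⟨i, hi⟩)
      rw [hpair] at h1
      simpa [Pi.single_apply] using h1
    · have hi := (hr i).1 hk
      have h1 := h ((cotangentCoord φ).symm (Pi.single (Sum.inl i) 1)) ((hL _).2 fun k hk' => by
        rw [LinearEquiv.apply_symm_apply, Pi.single_eq_of_ne]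
        rintro rfl
        exact hk' ⟨i, hi⟩)
      rw [hpair] at h1
      simpa [Pi.single_apply] using h1

/-- The weights that are trivial on the isotropy group `H` of a point of the shell with closed orbit
satisfy a relation involving all of them, and `H` is their common kernel. -/
theorem IsWeightCoord.exists_relation_of_isotropy (hG : IsReductive G) (hρ : IsRational ρ)
    {φ : V ≃ₗ[ℂ] (ι → ℂ)} {χ : ι → regularCharacters G} (hφ : IsWeightCoord ρ φ χ)
    {u : V × Module.Dual ℂ V} (hu : u ∈ shell ρ hρ) (hclosed : HasClosedOrbit (cotangentRep ρ) u)
    {H : Subgroup G} (hiso : isotropy (cotangentRep ρ) u = H) :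
    (∃ m : ι → ℤ, ∏ i, χ i ^ m i = 1 ∧ ∀ i, m i ≠ 0 ↔ ∀ g ∈ H, (χ i).1 g = 1) ∧
      ∀ g, g ∈ H ↔ ∀ i, (∀ h ∈ H, (χ i).1 h = 1) → (χ i).1 g = 1 := by
  classical
  have hΦ := hφ.cotangent
  obtain ⟨Φ, hΦdef⟩ : ∃ Φ, Φ = cotangentCoord φ := ⟨_, rfl⟩
  rw [← hΦdef] at hΦ
  -- `B` is the set of weights trivial on `H`, and contains the set `A` of weights occurring in `u`
  let A : Set ι := {i | Φ u (Sum.inl i) ≠ 0 ∨ Φ u (Sum.inr i) ≠ 0}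
  let B : Set ι := {i | ∀ g ∈ H, (χ i).1 g = 1}
  have hmemH : ∀ g, g ∈ H ↔ ∀ i ∈ A, (χ i).1 g = 1 := by
    intro g
    rw [← hiso, hΦ.mem_isotropy_iff]
    constructor
    · rintro h i (hi | hi)
      · exact h (Sum.inl i) hi
      · simpa using! h (Sum.inr i) hi
    · rintro h (i | i) hi
      · exact h i (Or.inl hi)
      · simpa using! h i (Or.inr hi)
  have hAB : A ⊆ B := fun i hi g hg => (hmemH g).1 hg i hi
  refine ⟨?_, fun g => ⟨fun hg i hi => hi g hg,
    fun hg => (hmemH g).2 fun i hi => hg i (hAB hi)⟩⟩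
  exact exists_zpow_relation_support_eq χ B (by
    intro j hj
    by_cases hjA : j ∈ A
    · by_cases hprod : Φ u (Sum.inl j) * Φ u (Sum.inr j) = 0
      · -- exactly one of `χ j`, `(χ j)⁻¹` occurs in `u`, so the relation given by the closed orbit
        -- involves `χ j`
        obtain ⟨a, ha, hasupp⟩ := hΦ.exists_relation u hclosed
        refine ⟨fun i => (a (Sum.inl i) : ℤ) - a (Sum.inr i), ?_, fun i hi => hAB ?_, ?_⟩
        · rw [Fintype.prod_sum_type] at ha
          simpa [zpow_sub, Finset.prod_mul_distrib] using ha
        · by_contra hiA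
          simp only [A, Set.mem_ofPred_eq, not_or, ← hasupp, not_not] at hiA
          exact hi (by simp [hiA.1, hiA.2])
        · rcases mul_eq_zero.1 hprod with h0 | h0
          · have h1 : a (Sum.inl j) = 0 := by
              by_contra h; exact (hasupp _).1 h h0
            have h2 : a (Sum.inr j) ≠ 0 :=
              (hasupp _).2 (hjA.resolve_left fun h => h h0)
            change (a (Sum.inl j) : ℤ) - a (Sum.inr j) ≠ 0
            omega
          · have h1 : a (Sum.inr j) = 0 := by
              by_contra h; exact (hasupp _).1 h h0
            have h2 : a (Sum.inl j) ≠ 0 :=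
              (hasupp _).2 (hjA.resolve_right fun h => h h0)
            change (a (Sum.inl j) : ℤ) - a (Sum.inr j) ≠ 0
            omega
      · obtain ⟨m, h1, h2, h3⟩ := hφ.exists_relation_of_mem_shell hG hρ hu j (hΦdef ▸ hprod)
        rw [← hΦdef] at h2
        exact ⟨m, h1, fun i hi => hAB (Or.inl (left_ne_zero_of_mul (h2 i hi))), h3⟩
    · -- a weight of `B` outside `A` is a monomial in the weights of `A`
      obtain ⟨m, hm⟩ := exists_eq_prod_zpow_of_forall_eq_one hG (fun i : A => χ i) (χ j)
        fun g hg => hj g ((hmemH g).2 fun i hi => hg ⟨i, hi⟩)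
      refine ⟨fun i => if h : i ∈ A then m ⟨i, h⟩ else if i = j then -1 else 0, ?_,
        fun i hi => ?_, by simp [hjA]⟩
      · have h1 : ∀ i, χ i ^ (if h : i ∈ A then m ⟨i, h⟩ else if i = j then -1 else 0) =
            (if h : i ∈ A then χ i ^ m ⟨i, h⟩ else 1) * (if i = j then (χ j)⁻¹ else 1) := by
          intro i
          by_cases hi : i ∈ A
          · have : i ≠ j := fun h => hjA (h ▸ hi)
            simp [hi, this]
          · by_cases hij : i = j
            · subst hij
              simp [hi]
            · simp [hi, hij]
        simp only [h1, Finset.prod_mul_distrib, Finset.prod_ite_eq', Finset.mem_univ, if_true]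
        rw [mul_inv_eq_one, hm, Finset.prod_dite]
        simp only [Finset.prod_const_one, mul_one]
        exact Finset.prod_bij' (fun i _ => ⟨i.1, (Finset.mem_filter.1 i.2).2⟩)
          (fun i _ => ⟨i.1, Finset.mem_filter.2 ⟨Finset.mem_univ _, i.2⟩⟩)
          (by simp) (by simp) (by simp) (by simp) (by simp)
      · by_cases hiA : i ∈ A
        · exact hAB hiA
        · by_cases hij : i = j
          · exact hij ▸ hj
          · simp [hiA, hij] at hi)

/-- The conclusion for a module with given weight coordinates. The sum of a relation among all
weights and of a large multiple of one among the weights trivial on `H` provides signs that are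
compatible with both relations, and hence the Lagrangian submodule. -/
theorem IsWeightCoord.exists_lagrangian (hG : IsReductive G) (hρ : IsRational ρ)
    (hfaithful : Function.Injective ρ) (hmod : IsModular 1 ρ)
    {φ : V ≃ₗ[ℂ] (ι → ℂ)} {χ : ι → regularCharacters G} (hφ : IsWeightCoord ρ φ χ)
    {u : V × Module.Dual ℂ V} (hu : u ∈ shell ρ hρ) (hclosed : HasClosedOrbit (cotangentRep ρ) u)
    {H : Subgroup G} (hiso : isotropy (cotangentRep ρ) u = H) :
    ∃ L : Subrepresentation (cotangentRep ρ), IsLagrangian L.toSubmodule ∧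
      IsStable L.toRepresentation ∧
      IsStable (fixedSubmodule L.toRepresentation H).toRepresentation ∧
      IsPrincipalIsotropy (fixedSubmodule L.toRepresentation H).toRepresentation H := by
  classical
  obtain ⟨⟨mB, hmB, hmBsupp⟩, hmemH⟩ := hφ.exists_relation_of_isotropy hG hρ hu hclosed hiso
  have hΦ := hφ.cotangent
  let B : Set ι := {i | ∀ g ∈ H, (χ i).1 g = 1}
  obtain ⟨m₀, hm₀, hm₀supp⟩ := exists_zpow_relation_support_eq χ Set.univ (by
    intro j _
    obtain ⟨m, h1, h2⟩ := hφ.exists_relation_of_isModular hG hfaithful hmod j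
    exact ⟨m, h1, fun _ _ => trivial, h2⟩)
  obtain ⟨N, hN⟩ := exists_dominating_multiple mB m₀
  obtain ⟨m, hmdef⟩ : ∃ m : ι → ℤ, m = fun i => m₀ i + N * mB i := ⟨_, rfl⟩
  have hm : ∏ i, χ i ^ m i = 1 := hmdef ▸ prod_zpow_add_mul χ N hmB hm₀
  have hmsign : ∀ i, mB i ≠ 0 → 0 < m i * mB i := fun i hi => hmdef ▸ hN i hi
  have hm0 : ∀ i, m i ≠ 0 := by
    intro i
    by_cases hi : mB i = 0
    · simpa [hmdef, hi] using (hm₀supp i).2 trivial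
    · exact left_ne_zero_of_mul (hmsign i hi).ne'
  -- the Lagrangian submodule consists of the weight lines on which `m` is positive
  let s : ι → ι ⊕ ι := fun i => if 0 < m i then Sum.inl i else Sum.inr i
  have hs : ∀ i, s i = Sum.inl i ∨ s i = Sum.inr i := fun i => by
    by_cases h : 0 < m i <;> simp [s, h]
  have hsinj : Function.Injective s := by
    intro i j hij
    rcases hs i with h | h <;> rcases hs j with h' | h' <;> rw [h, h'] at hij
    · exact Sum.inl_injective hij
    · cases hij
    · cases hij
    · exact Sum.inr_injective hij
  let L : Subrepresentation (cotangentRep ρ) :=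
    { toSubmodule :=
        { carrier := {w | ∀ k, k ∉ Set.range s → cotangentCoord φ w k = 0}
          zero_mem' := by intro k _; simp
          add_mem' := by
            intro a b ha hb k hk
            simp [ha k hk, hb k hk]
          smul_mem' := by
            intro c a ha k hk
            simp [ha k hk] }
      apply_mem_toSubmodule := by
        intro g w hw k hk
        rw [hΦ, hw k hk, mul_zero] }
  have hL : ∀ w, w ∈ L.toSubmodule ↔ ∀ k, k ∉ Set.range s → cotangentCoord φ w k = 0 :=
    fun _ => Iff.rfl
  obtain ⟨φL, -, hφL⟩ := hΦ.restrict L s hsinj hL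
  obtain ⟨ψ, hψ⟩ : ∃ ψ : ι → regularCharacters G,
    ψ = fun i => Sum.elim χ (fun i => (χ i)⁻¹) (s i) := ⟨_, rfl⟩
  rw [← hψ] at hφL
  -- a relation with the signs of `m` becomes a relation with positive exponents on `L`
  have hpow : ∀ (i : ι) (k : ℤ), (k ≠ 0 → 0 < m i * k) → ψ i ^ k.natAbs = χ i ^ k := by
    intro i k hk
    rcases eq_or_ne k 0 with rfl | hk0
    · simp
    · by_cases hi : 0 < m i
      · have hkpos : 0 < k := (pos_iff_pos_of_mul_pos (hk hk0)).1 hi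
        obtain ⟨n, rfl⟩ := Int.eq_ofNat_of_zero_le hkpos.le
        simp [hψ, s, hi]
      · have hkneg : k ≤ 0 := by
          by_contra h
          exact absurd (hk hk0) (by nlinarith)
        obtain ⟨n, hn⟩ := Int.eq_ofNat_of_zero_le (neg_nonneg.2 hkneg)
        obtain rfl : k = -(n : ℤ) := by omega
        simp [hψ, s, hi]
  have hψone : ∀ i g, (ψ i).1 g = 1 ↔ (χ i).1 g = 1 := by
    intro i g
    rcases hs i with h | h <;> simp [hψ, h]
  have hfix : ∀ w, w ∈ (fixedSubmodule L.toRepresentation H).toSubmodule ↔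
      ∀ k, k ∉ Set.range (Subtype.val : B → ι) → φL w k = 0 := by
    intro w
    have h1 : w ∈ (fixedSubmodule L.toRepresentation H).toSubmodule ↔
        ∀ g ∈ H, g ∈ isotropy L.toRepresentation w :=
      ⟨fun h g hg => h ⟨g, hg⟩, fun h g => h g.1 g.2⟩
    rw [h1]
    simp only [hφL.mem_isotropy_iff, hψone, Subtype.range_coe]
    constructor
    · intro h k hk
      by_contra h0
      exact hk fun g hg => h g hg k h0
    · intro h g hg k hk
      by_contra h0
      exact hk (h k fun hkB => h0 (hkB g hg))
  obtain ⟨φB, -, hφB⟩ := hφL.restrict (fixedSubmodule L.toRepresentation H)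
    (Subtype.val : B → ι) Subtype.val_injective hfix
  have hrelB : ∏ i : B, ψ i ^ (mB i).natAbs = 1 := by
    rw [← hmB]
    refine Eq.trans ?_ (Finset.prod_congr rfl fun i _ => hpow i (mB i) (hmsign i))
    refine Finset.prod_bij_ne_one (fun i _ _ => i.1) (fun _ _ _ => Finset.mem_univ _)
      (fun _ _ _ _ _ _ h => Subtype.ext h) (fun i _ hi => ?_) (fun _ _ _ => rfl)
    refine ⟨⟨i, (hmBsupp i).1 fun h0 => hi (by simp [h0])⟩, Finset.mem_univ _, hi, rfl⟩
  have hposB : ∀ i : B, (mB i).natAbs ≠ 0 := fun i => Int.natAbs_ne_zero.2 ((hmBsupp i).2 i.2)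
  refine ⟨L, isLagrangian_of_section φ s hs _ hL, ?_, ?_, ?_⟩
  · refine hφL.isStable hG (fun i => (m i).natAbs) ?_ fun i => Int.natAbs_ne_zero.2 (hm0 i)
    rw [← hm]
    exact Finset.prod_congr rfl fun i _ => hpow i (m i) fun h => mul_self_pos.2 h
  · exact hφB.isStable hG _ hrelB hposB
  · refine hφB.isPrincipalIsotropy hG _ hrelB hposB H fun g => ?_
    simp only [hψone]
    exact ⟨fun hg i => i.2 g hg, fun h => (hmemH g).2 fun i hi => h ⟨i, hi⟩⟩

end Coordinates

end AlgGroup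

end

theorem mainTheorem8 {G : Type*} [CommGroup G] [AlgGroup.AffineAlgebraicGroup G]
    (hG : AlgGroup.IsReductive G)
    {V : Type*} [AddCommGroup V] [Module ℂ V] [FiniteDimensional ℂ V]
    (ρ : Representation ℂ G V) (hρ : AlgGroup.IsRational ρ)
    (hfaithful : Function.Injective ρ) (hmod : AlgGroup.IsModular 1 ρ)
    (H : Subgroup G)
    (hH : ∃ u ∈ AlgGroup.shell ρ hρ, u ≠ 0 ∧
      AlgGroup.HasClosedOrbit (AlgGroup.cotangentRep ρ) u ∧
      AlgGroup.isotropy (AlgGroup.cotangentRep ρ) u = H) :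
    ∃ L : Subrepresentation (AlgGroup.cotangentRep ρ),
      AlgGroup.IsLagrangian L.toSubmodule ∧
      AlgGroup.IsStable L.toRepresentation ∧
      AlgGroup.IsStable (AlgGroup.fixedSubmodule L.toRepresentation H).toRepresentation ∧
      AlgGroup.IsPrincipalIsotropy
        (AlgGroup.fixedSubmodule L.toRepresentation H).toRepresentation H := by
  obtain ⟨u, hu, -, hclosed, hiso⟩ := hH
  obtain ⟨φ, χ, hφ⟩ := AlgGroup.exists_weightCoord hG ρ hρ
  exact hφ.exists_lagrangian hG hρ hfaithful hmod hu hclosed hiso
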